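/- For each $n\in\mathbb N=\{1,2,\dots\}$, on a probability space $(\Omega^n,\mathcal F^n,\mathbb P^n)$, consider a double-ended queue with the following data. $\{U^n_k\}_{k\ge1}$ and $\{V^n_k\}_{k\ge1}$ are sequences of i.i.d. almost surely strictly positive random variables with means $1/\alpha^n$, $1/\beta^n$ and finite standard deviations $\sigma^n$, $\varsigma^n$ (the inter-arrival times of sellers and buyers), and $N^n_s(t)=\max\{k\ge 0:\sum_{i=1}^kU^n_i\le t\}$, $N^n_b(t)=\max\{k\ge 0:\sum_{i=1}^kV^n_i\le t\}$; $N^n_{sr}$ and $N^n_{br}$ are unit-rate Poisson processes; $\theta^n,\gamma^n>0$; $X^n(0)$ is an integer-valued random variable; and $X^n(0)$, $\{U^n_k\}$, $\{V^n_k\}$, $N^n_{sr}$, $N^n_{br}$ are mutually independent. The $\mathbb Z$-valued queue length process $X^n$ satisfies, almost surely, for all $t\ge0$, $$X^n(t)=X^n(0)+N^n_s(t)-N^n_b(t)-N^n_{sr}\Big(\theta^n\int_0^t (X^n(s))^+ds\Big)+N^n_{br}\Big(\gamma^n\int_0^t (X^n(s))^-ds\Big),$$ where $a^+=\max\{a,0\}$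 and $a^-=\max\{-a,0\}$. Assume that the families $\{(U^n_1)^2\}_{n}$ and $\{(V^n_1)^2\}_{n}$ are uniformly integrable, and that, as $n\to\infty$, $\alpha^n\to\alpha$, $\beta^n\to\beta$, $\sigma^n\to\sigma$, $\varsigma^n\to\varsigma$, $n\theta^n\to\theta$, $n\gamma^n\to\gamma$ for some $\alpha,\beta,\sigma,\varsigma,\theta,\gamma\in(0,\infty)$. Let $\bar X^n(t)=X^n(nt)/n$. Suppose that $\mathbb E|\bar X^n(0)-x_0|\to0$ for some $x_0\in\mathbb R$. Then the integral equation $$x(t)=x_0+(\alpha-\beta)t-\theta\int_0^t x^+(s)\,ds+\gamma\int_0^t x^-(s)\,ds,\qquad t\ge0,$$ has a unique solution $x$ on $[0,\infty)$, and for every $t\in[0,\infty)$, $$\mathbb E\Big(\sup_{0\le s\le t}|\bar X^n(s)-x(s)|\Big)\to0\quad\text{as }n\to\infty.$$ -/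

import Mathlib

open MeasureTheory ProbabilityTheory Filter Topology
open scoped NNReal ENNReal

namespace DoubleEnded

/-- A unit-rate Poisson process: it starts at `0`, has independent increments, the increment over
`(s, t]` is Poisson with mean `t - s`, and almost every path is nondecreasing and
right-continuous.  (The truncated subtractions are genuine: paths are a.s. nondecreasing,
and `s ≤ t` below.) -/
structure IsUnitPoissonProcess {Ω : Type*} [MeasurableSpace Ω] (P : Measure Ω)
    (N : ℝ≥0 → Ω → ℕ) : Prop where
  measurable : ∀ t, Measurable (N t)
  zero : ∀ᵐ ω ∂P, N 0 ω = 0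
  indep_increments : HasIndepIncrements N P
  law_increments : ∀ s t : ℝ≥0, s ≤ t →
    HasLaw (fun ω => N t ω - N s ω) (poissonMeasure (t - s)) P
  mono : ∀ᵐ ω ∂P, Monotone fun t => N t ω
  right_continuous : ∀ᵐ ω ∂P, ∀ t, ContinuousWithinAt (fun s => N s ω) (Set.Ici t) t

/-- `U 0, U 1, …` are i.i.d., almost surely strictly positive random variables with mean
`1 / rate` and (finite) standard deviation `sd`. -/
structure IsInterarrivalSequence {Ω : Type*} [MeasurableSpace Ω] (P : Measure Ω)
    (U : ℕ → Ω → ℝ) (rate sd : ℝ) : Prop where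
  measurable : ∀ k, Measurable (U k)
  indep : iIndepFun U P
  identDistrib : ∀ k, IdentDistrib (U k) (U 0) P P
  pos : ∀ᵐ ω ∂P, 0 < U 0 ω
  memLp : MemLp (U 0) 2 P
  rate_pos : 0 < rate
  mean : ∫ ω, U 0 ω ∂P = 1 / rate
  sd_nonneg : 0 ≤ sd
  variance : Var[U 0; P] = sd ^ 2

/-- The renewal counting process `max {k : U_1 + ⋯ + U_k ≤ t}`, where `U_{k+1}` is written
`U k`. -/
noncomputable def renewalCount {Ω : Type*} (U : ℕ → Ω → ℝ) (t : ℝ) (ω : Ω) : ℕ :=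
  sSup {k : ℕ | ∑ i ∈ Finset.range k, U i ω ≤ t}

/-- The σ-algebra generated by a family of random variables. -/
abbrev generatedBy {ι Ω E : Type*} [MeasurableSpace E] (Y : ι → Ω → E) : MeasurableSpace Ω :=
  ⨆ i, MeasurableSpace.comap (Y i) inferInstance

/-- A double-ended queue with renewal arrivals and exponential patience times on the
probability space `(Ω, P)`.  `X t` is the signed queue length at time `t ≥ 0` (positive: sellers,
negative: buyers); the values at negative times play no role. -/
structure DoubleEndedQueue (Ω : Type*) [MeasurableSpace Ω] (P : Measure Ω) where
  /-- arrival rate of sellers -/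
  α : ℝ
  /-- arrival rate of buyers -/
  β : ℝ
  /-- standard deviation of the inter-arrival times of sellers -/
  σ : ℝ
  /-- standard deviation of the inter-arrival times of buyers -/
  ς : ℝ
  /-- reneging rate of sellers -/
  θ : ℝ
  /-- reneging rate of buyers -/
  γ : ℝ
  /-- inter-arrival times of sellers -/
  U : ℕ → Ω → ℝ
  /-- inter-arrival times of buyers -/
  V : ℕ → Ω → ℝ
  /-- Poisson process driving the abandonments of sellers -/
  Nsr : ℝ≥0 → Ω → ℕ
  /-- Poisson process driving the abandonments of buyers -/
  Nbr : ℝ≥0 → Ω → ℕ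
  /-- queue length process -/
  X : ℝ → Ω → ℤ
  θ_pos : 0 < θ
  γ_pos : 0 < γ
  interarrival_sellers : IsInterarrivalSequence P U α σ
  interarrival_buyers : IsInterarrivalSequence P V β ς
  poisson_sellers : IsUnitPoissonProcess P Nsr
  poisson_buyers : IsUnitPoissonProcess P Nbr
  measurable_X : ∀ t, 0 ≤ t → Measurable (X t)
  /-- `X 0`, the two inter-arrival sequences and the two Poisson processes are mutually
  independent. -/
  indep : iIndep ![MeasurableSpace.comap (X 0) inferInstance, generatedBy U, generatedBy V,
    generatedBy Nsr, generatedBy Nbr] P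
  /-- Almost every path is locally integrable on `[0, ∞)` -/
  locallyIntegrable_X : ∀ᵐ ω ∂P, ∀ t, 0 ≤ t →
    IntervalIntegrable (fun s => (X s ω : ℝ)) volume 0 t
  /-- … and satisfies the evolution equation. -/
  evolution : ∀ᵐ ω ∂P, ∀ t, 0 ≤ t →
    X t ω = X 0 ω + (renewalCount U t ω : ℤ) - (renewalCount V t ω : ℤ)
      - (Nsr (Real.toNNReal (θ * ∫ s in (0 : ℝ)..t, max (X s ω : ℝ) 0)) ω : ℤ)
      + (Nbr (Real.toNNReal (γ * ∫ s in (0 : ℝ)..t, max (-(X s ω : ℝ)) 0)) ω : ℤ)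

/-- The fluid scaled process `X (n t) / n`. -/
noncomputable def DoubleEndedQueue.fluidScaled {Ω : Type*} [MeasurableSpace Ω] {P : Measure Ω}
    (Q : DoubleEndedQueue Ω P) (n : ℕ+) (t : ℝ) (ω : Ω) : ℝ :=
  (Q.X ((n : ℝ) * t) ω : ℝ) / (n : ℝ)

/-- Uniform integrability of random variables `Y n` living on possibly different probability
spaces `(Ω n, P n)`: `sup_n E^n[|Y n|; |Y n| ≥ K] → 0` as `K → ∞`. -/
def UniformlyIntegrableFamily {ι : Type*} {Ω : ι → Type*} [∀ n, MeasurableSpace (Ω n)]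
    (P : ∀ n, Measure (Ω n)) (Y : ∀ n, Ω n → ℝ) : Prop :=
  ∀ ε : ℝ, 0 < ε → ∃ K : ℝ, ∀ n,
    ∫⁻ ω in {ω | K ≤ |Y n ω|}, ENNReal.ofReal |Y n ω| ∂(P n) ≤ ENNReal.ofReal ε

/-- `x` solves `x(t) = x₀ + (α - β) t - θ ∫₀ᵗ x⁺ + γ ∫₀ᵗ x⁻` on `[0, ∞)` (integrability makes the
integrals meaningful; a solution is then automatically continuous). -/
def IsFluidSolution (α β θ γ x₀ : ℝ) (x : ℝ → ℝ) : Prop :=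
  ∀ t, 0 ≤ t → IntervalIntegrable x volume 0 t ∧
    x t = x₀ + (α - β) * t - θ * (∫ s in (0 : ℝ)..t, max (x s) 0)
      + γ * ∫ s in (0 : ℝ)..t, max (-x s) 0

end DoubleEnded

/-!
The fluid limit is a continuity argument: the scaled path solves the fluid equation up to an
error term, and Gronwall's inequality turns a bound on that error into a bound on the distance to
the fluid path (`IsFluidSolution.abs_sub_le`); it also gives uniqueness. Existence is a fixed
point argument on `[0, ∞)` in an exponentially weighted sup norm
(`exists_continuous_integral_equation`).

The error consists of the fluctuations of the two renewal processes and of the two time-changed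
Poisson processes around their means, plus the effect of replacing `n θⁿ`, `n γⁿ` by their limits.
Since the processes are monotone and their means are linear, the supremum of a fluctuation over an
interval is bounded by the fluctuations at finitely many grid points plus the mesh
(`abs_sub_mul_le_grid`), so no maximal inequality is needed: only `L¹` bounds at fixed times.

* For renewal processes these are `IsInterarrivalSequence.lintegral_abs_renewalCount_sub_le`. The
  upper deviation is bounded by a geometric series of exponential moments of the partial sums, the
  lower deviation by Chebyshev's inequality.
* For a Poisson process, `E |N r - r| ≤ r / a + a` for all `a > 0`. The clocks of the Poisson
  processes are random and depend on the whole system, but they are bounded by a multiple of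
  `DoubleEndedQueue.pathBound`, one plus the initial population plus the number of arrivals, which
  is independent of the Poisson processes; conditioning on its value gives
  `IsUnitPoissonProcess.lintegral_gridError_le`.

That the queue length is dominated by `pathBound` (`DoubleEndedQueue.ae_abs_le_pathBound`) is
seen by looking back to the last time at which the path was nonpositive: from then on no buyer
abandons, so the path can rise only through arriving sellers. The jump at that very time is at
most `1`, because a Poisson process almost surely has unit jumps
(`IsUnitPoissonProcess.ae_unit_jumps`).

All expectations are Lebesgue integrals in `[0, ∞]`, and the supremum over time is only ever
bounded by a measurable function, so its measurability plays no role.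
-/

namespace DoubleEnded

/-! ### The fluid equation -/

theorem _root_.IntervalIntegrable.max_zero {f : ℝ → ℝ} {a b : ℝ}
    (h : IntervalIntegrable f volume a b) :
    IntervalIntegrable (fun r => max (f r) 0) volume a b :=
  ⟨h.1.pos_part, h.2.pos_part⟩

/-- Gronwall's inequality in integral form, for an integrable function that need not be
continuous: it applies to the jump paths of the queue. -/
theorem le_mul_exp_of_le_add_integral {u : ℝ → ℝ} {D L T : ℝ} (hL : 0 ≤ L)
    (hu : IntervalIntegrable u volume 0 T)
    (h : ∀ t ∈ Set.Icc 0 T, u t ≤ D + L * ∫ s in (0 : ℝ)..t, u s) :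
    ∀ t ∈ Set.Icc 0 T, u t ≤ D * Real.exp (L * t) := by
  intro t ht
  have hT : 0 ≤ T := ht.1.trans ht.2
  -- extending `u` by zero makes its primitive continuous on all of `ℝ`
  set ũ : ℝ → ℝ := (Set.Ioc 0 T).indicator u with hũ
  have hint : Integrable ũ := by
    rw [hũ, integrable_indicator_iff measurableSet_Ioc]
    exact (intervalIntegrable_iff_integrableOn_Ioc_of_le hT).1 hu
  have hI : ∀ s ∈ Set.Icc 0 T, ∫ r in (0 : ℝ)..s, u r = ∫ r in (0 : ℝ)..s, ũ r := by
    intro s hs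
    rw [intervalIntegral.integral_of_le hs.1, intervalIntegral.integral_of_le hs.1]
    refine setIntegral_congr_fun measurableSet_Ioc fun r hr => ?_
    exact (Set.indicator_of_mem (show r ∈ Set.Ioc 0 T from ⟨hr.1, hr.2.trans hs.2⟩) u).symm
  have hcI : Continuous fun s => ∫ r in (0 : ℝ)..s, ũ r :=
    intervalIntegral.continuous_primitive (fun a b => hint.intervalIntegrable) 0
  set v : ℝ → ℝ := fun s => D + L * ∫ r in (0 : ℝ)..s, ũ r with hv
  have hcv : Continuous v := by fun_prop
  set f : ℝ → ℝ := fun s => D + L * ∫ r in (0 : ℝ)..s, v r with hf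
  have hderiv : ∀ s, HasDerivAt f (L * v s) s := fun s =>
    ((hcv.integral_hasStrictDerivAt 0 s).hasDerivAt.const_mul L).const_add D
  have huv : ∀ s ∈ Set.Icc 0 T, u s ≤ v s := fun s hs => by
    simpa only [hv, hI s hs] using h s hs
  have hvf : ∀ s ∈ Set.Icc 0 T, v s ≤ f s := by
    intro s hs
    simp only [hv, hf]
    gcongr
    rw [← hI s hs]
    refine intervalIntegral.integral_mono_on hs.1 ?_ (hcv.intervalIntegrable _ _) ?_
    · exact hu.mono_set (by
        rw [Set.uIcc_of_le hs.1, Set.uIcc_of_le hT]; exact Set.Icc_subset_Icc_right hs.2)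
    · exact fun r hr => huv r ⟨hr.1, hr.2.trans hs.2⟩
  have hcf : Continuous f := continuous_iff_continuousAt.2 fun s => (hderiv s).continuousAt
  have key := le_gronwallBound_of_liminf_deriv_right_le (f := f) (f' := fun s => L * v s)
    (δ := D) (K := L) (ε := 0) (a := 0) (b := T) hcf.continuousOn
    (fun s _ r hr => (hderiv s).hasDerivWithinAt.liminf_right_slope_le hr)
    (by simp [hf]) (fun s hs => by
      have := hvf s ⟨hs.1, hs.2.le⟩
      nlinarith) t ht
  rw [gronwallBound_ε0, sub_zero] at key
  exact (huv t ht).trans ((hvf t ht).trans key)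

/-- Integration gains a factor `1 / c` in the norm weighted by `exp (-c t)`; this is what makes the
Picard map a contraction. -/
theorem abs_integral_le_of_abs_le_exp {g : ℝ → ℝ} {C c t : ℝ} (hc : 0 < c) (ht : 0 ≤ t)
    (hC : 0 ≤ C) (hg : ∀ s ∈ Set.Icc 0 t, |g s| ≤ C * Real.exp (c * s)) :
    |∫ s in (0 : ℝ)..t, g s| ≤ C / c * Real.exp (c * t) := by
  have hexp : ∀ s, HasDerivAt (fun s => C / c * Real.exp (c * s)) (C * Real.exp (c * s)) s := by
    intro s
    have h1 : HasDerivAt (fun s => c * s) c s := by simpa using (hasDerivAt_id s).const_mul c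
    have h2 : C * Real.exp (c * s) = C / c * (Real.exp (c * s) * c) := by field_simp
    rw [h2]
    exact h1.exp.const_mul (C / c)
  have h1 : ‖∫ s in (0 : ℝ)..t, g s‖ ≤ ∫ s in (0 : ℝ)..t, C * Real.exp (c * s) := by
    refine intervalIntegral.norm_integral_le_of_norm_le ht ?_ ?_
    · exact Eventually.of_forall fun s hs => hg s ⟨hs.1.le, hs.2⟩
    · exact Continuous.intervalIntegrable (by fun_prop) _ _
  rw [intervalIntegral.integral_eq_sub_of_hasDerivAt (fun s _ => hexp s)
    (Continuous.intervalIntegrable (by fun_prop) _ _)] at h1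
  have : 0 ≤ C / c * Real.exp (c * 0) := by positivity
  rw [Real.norm_eq_abs] at h1
  linarith

/-- Global existence for an autonomous integral equation with Lipschitz right-hand side: Banach's
fixed point theorem for `z t = exp (-c t) * x t` with `c = K + 1`, on bounded continuous functions
on all of `[0, ∞)` at once. -/
theorem exists_continuous_integral_equation {F : ℝ → ℝ} {K : ℝ≥0} (hF : LipschitzWith K F)
    (x₀ : ℝ) :
    ∃ x : ℝ → ℝ, Continuous x ∧ ∀ t, 0 ≤ t → x t = x₀ + ∫ s in (0 : ℝ)..t, F (x s) := by
  set c : ℝ := K + 1 with hc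
  have hc0 : 0 < c := by positivity
  have hFc := hF.continuous
  have hFl : ∀ a b, |F a - F b| ≤ K * |a - b| := fun a b => by
    simpa [Real.dist_eq] using hF.dist_le_mul a b
  let φ : (ℝ → ℝ) → ℝ → ℝ := fun z t => Real.exp (-(c * max t 0)) *
    (x₀ + ∫ s in (0 : ℝ)..max t 0, F (Real.exp (c * s) * z s))
  have hint : ∀ z : BoundedContinuousFunction ℝ ℝ,
      Continuous fun s => F (Real.exp (c * s) * z s) := fun z =>
    hFc.comp ((by fun_prop : Continuous fun s => Real.exp (c * s)).mul z.continuous)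
  have hφc : ∀ z : BoundedContinuousFunction ℝ ℝ, Continuous (φ z) := by
    intro z
    have h1 : Continuous fun t => ∫ s in (0 : ℝ)..t, F (Real.exp (c * s) * z s) :=
      intervalIntegral.continuous_primitive (fun a b => (hint z).intervalIntegrable a b) 0
    have h2 := h1.comp (continuous_id.max continuous_const : Continuous fun t : ℝ => max t 0)
    exact (by fun_prop : Continuous fun t => Real.exp (-(c * max t 0))).mul
      (continuous_const.add h2)
  have hbound : ∀ z : BoundedContinuousFunction ℝ ℝ, ∀ t,
      ‖φ z t‖ ≤ |x₀| + (|F 0| + K * ‖z‖) / c := by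
    intro z t
    have ht : 0 ≤ max t 0 := le_max_right _ _
    have h1 := abs_integral_le_of_abs_le_exp (g := fun s => F (Real.exp (c * s) * z s))
      (C := |F 0| + K * ‖z‖) hc0 ht (by positivity) (fun s hs => by
        have h2 := hFl (Real.exp (c * s) * z s) 0
        have h3 : 1 ≤ Real.exp (c * s) := Real.one_le_exp (mul_nonneg hc0.le hs.1)
        have h4 : |z s| ≤ ‖z‖ := z.norm_coe_le_norm s
        rw [sub_zero, abs_mul, Real.abs_exp] at h2
        have h5 := abs_sub_abs_le_abs_sub (F (Real.exp (c * s) * z s)) (F 0)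
        have h6 : (K : ℝ) * (Real.exp (c * s) * |z s|) ≤ K * (Real.exp (c * s) * ‖z‖) := by
          gcongr
        nlinarith [abs_nonneg (F 0)])
    have hE : 0 < Real.exp (-(c * max t 0)) := Real.exp_pos _
    have hE1 : Real.exp (-(c * max t 0)) ≤ 1 := Real.exp_le_one_iff.2 (by
      have := mul_nonneg hc0.le ht
      linarith)
    have hE2 : Real.exp (-(c * max t 0)) * Real.exp (c * max t 0) = 1 := by
      rw [← Real.exp_add]; simp
    rw [Real.norm_eq_abs, abs_mul, Real.abs_exp]
    calc _ ≤ Real.exp (-(c * max t 0)) *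
          (|x₀| + (|F 0| + K * ‖z‖) / c * Real.exp (c * max t 0)) := by
          gcongr
          exact (abs_add_le _ _).trans (by gcongr)
      _ = Real.exp (-(c * max t 0)) * |x₀| + (|F 0| + K * ‖z‖) / c *
          (Real.exp (-(c * max t 0)) * Real.exp (c * max t 0)) := by ring
      _ ≤ _ := by
          rw [hE2, mul_one]
          gcongr
          exact mul_le_of_le_one_left (abs_nonneg _) hE1
  let Φ : BoundedContinuousFunction ℝ ℝ → BoundedContinuousFunction ℝ ℝ := fun z =>
    BoundedContinuousFunction.ofNormedAddCommGroup (φ z) (hφc z) _ (hbound z)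
  have hcontr : ContractingWith (K / (K + 1)) Φ := by
    refine ⟨?_, LipschitzWith.of_dist_le_mul fun z w => ?_⟩
    · rw [div_lt_one (by positivity)]
      exact lt_add_one K
    · refine (BoundedContinuousFunction.dist_le (by positivity)).2 fun t => ?_
      have ht : 0 ≤ max t 0 := le_max_right _ _
      have h1 := abs_integral_le_of_abs_le_exp
        (g := fun s => F (Real.exp (c * s) * z s) - F (Real.exp (c * s) * w s))
        (C := K * dist z w) hc0 ht (by positivity) (fun s hs => by
          refine (hFl _ _).trans ?_
          rw [← mul_sub, abs_mul, Real.abs_exp]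
          have h4 : |z s - w s| ≤ dist z w := by
            simpa [Real.dist_eq] using z.dist_coe_le_dist (g := w) s
          calc _ ≤ K * (Real.exp (c * s) * dist z w) := by gcongr
            _ = _ := by ring)
      have hE2 : Real.exp (-(c * max t 0)) * Real.exp (c * max t 0) = 1 := by
        rw [← Real.exp_add]; simp
      have h2 : φ z t - φ w t = Real.exp (-(c * max t 0)) * ∫ s in (0 : ℝ)..max t 0,
          (F (Real.exp (c * s) * z s) - F (Real.exp (c * s) * w s)) := by
        simp only [φ]
        rw [intervalIntegral.integral_sub ((hint z).intervalIntegrable _ _)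
          ((hint w).intervalIntegrable _ _)]
        ring
      change dist (φ z t) (φ w t) ≤ _
      rw [Real.dist_eq, h2, abs_mul, Real.abs_exp]
      calc _ ≤ Real.exp (-(c * max t 0)) *
            (K * dist z w / c * Real.exp (c * max t 0)) := by gcongr
        _ = K * dist z w / c * (Real.exp (-(c * max t 0)) * Real.exp (c * max t 0)) := by ring
        _ = _ := by rw [hE2, mul_one]; push_cast; rw [hc]; ring
  set z := ContractingWith.fixedPoint Φ hcontr with hz
  have hfix : Φ z = z := hcontr.fixedPoint_isFixedPt
  refine ⟨fun t => Real.exp (c * t) * z t,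
    (by fun_prop : Continuous fun s => Real.exp (c * s)).mul z.continuous, fun t ht => ?_⟩
  have h1 : z t = φ z t := by
    conv_lhs => rw [← hfix]
    rfl
  have hE2 : Real.exp (c * t) * Real.exp (-(c * t)) = 1 := by
    rw [← Real.exp_add]; simp
  simp only
  rw [h1]
  simp only [φ, max_eq_left ht]
  rw [← mul_assoc, hE2, one_mul]

/-- Stability of the fluid equation: a path that solves it up to an error of size `e` stays within
a multiple of `|y₀ - x₀| + e` of the solution. The factor does not depend on the path. -/
theorem IsFluidSolution.abs_sub_le {α β θ γ x₀ y₀ e T : ℝ} {x y E : ℝ → ℝ} (hθ : 0 ≤ θ)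
    (hγ : 0 ≤ γ) (hx : IsFluidSolution α β θ γ x₀ x)
    (hy : IntervalIntegrable y volume 0 T)
    (hyE : ∀ t ∈ Set.Icc 0 T, y t = y₀ + (α - β) * t - θ * (∫ s in (0 : ℝ)..t, max (y s) 0)
      + γ * (∫ s in (0 : ℝ)..t, max (-y s) 0) + E t)
    (hE : ∀ t ∈ Set.Icc 0 T, |E t| ≤ e) :
    ∀ t ∈ Set.Icc 0 T, |y t - x t| ≤ (|y₀ - x₀| + e) * Real.exp ((θ + γ) * T) := by
  intro t ht
  have hT : 0 ≤ T := ht.1.trans ht.2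
  have hyt : ∀ s ∈ Set.Icc 0 T, IntervalIntegrable y volume 0 s := fun s hs =>
    hy.mono_set (by
      rw [Set.uIcc_of_le hs.1, Set.uIcc_of_le hT]; exact Set.Icc_subset_Icc_right hs.2)
  have he : 0 ≤ e := (abs_nonneg _).trans (hE t ht)
  have key := le_mul_exp_of_le_add_integral (u := fun s => |y s - x s|) (D := |y₀ - x₀| + e)
    (L := θ + γ) (T := T) (by positivity) (hy.sub (hx T hT).1).abs ?_ t ht
  · refine key.trans ?_
    have := ht.2
    gcongr
  intro s hs
  have iy := hyt s hs
  have ix := (hx s hs.1).1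
  have ia := (iy.sub ix).abs
  have hbd : ∀ {p : ℝ → ℝ}, (∀ a b, |p a - p b| ≤ |a - b|) →
      (IntervalIntegrable (fun r => p (y r)) volume 0 s) →
      (IntervalIntegrable (fun r => p (x r)) volume 0 s) →
      |(∫ r in (0 : ℝ)..s, p (y r)) - ∫ r in (0 : ℝ)..s, p (x r)|
        ≤ ∫ r in (0 : ℝ)..s, |y r - x r| := by
    intro p hp h1 h2
    rw [← intervalIntegral.integral_sub h1 h2]
    refine (intervalIntegral.abs_integral_le_integral_abs hs.1).trans ?_
    exact intervalIntegral.integral_mono_on hs.1 (h1.sub h2).abs ia fun r _ => hp _ _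
  have h1 := hbd (p := fun a => max a 0) (fun a b => abs_max_sub_max_le_abs a b 0)
    iy.max_zero ix.max_zero
  have h2 := hbd (p := fun a => max (-a) 0) (fun a b => by
    refine (abs_max_sub_max_le_abs (-a) (-b) 0).trans_eq ?_
    rw [← abs_neg]; ring_nf) iy.neg.max_zero ix.neg.max_zero
  have h3 := hE s hs
  have e1 := hyE s hs
  have e2 := (hx s hs.1).2
  set I := ∫ r in (0 : ℝ)..s, |y r - x r|
  have e3 : y s - x s = (y₀ - x₀) + E s
      - θ * ((∫ r in (0 : ℝ)..s, max (y r) 0) - ∫ r in (0 : ℝ)..s, max (x r) 0)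
      + γ * ((∫ r in (0 : ℝ)..s, max (-y r) 0) - ∫ r in (0 : ℝ)..s, max (-x r) 0) := by
    rw [e1, e2]; ring
  simp only [e3]
  refine (abs_add_le _ _).trans ?_
  have h4 := abs_sub (y₀ - x₀ + E s)
    (θ * ((∫ r in (0 : ℝ)..s, max (y r) 0) - ∫ r in (0 : ℝ)..s, max (x r) 0))
  have h5 := abs_add_le (y₀ - x₀) (E s)
  rw [abs_mul, abs_of_nonneg hθ] at h4
  rw [abs_mul, abs_of_nonneg hγ]
  nlinarith [mul_le_mul_of_nonneg_left h1 hθ, mul_le_mul_of_nonneg_left h2 hγ]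

theorem IsFluidSolution.eqOn {α β θ γ x₀ : ℝ} {x y : ℝ → ℝ} (hθ : 0 ≤ θ) (hγ : 0 ≤ γ)
    (hx : IsFluidSolution α β θ γ x₀ x) (hy : IsFluidSolution α β θ γ x₀ y) :
    Set.EqOn y x (Set.Ici 0) := by
  intro t ht
  have := hx.abs_sub_le hθ hγ (y := y) (y₀ := x₀) (E := 0) (e := 0) (hy t ht).1
    (fun s hs => by simpa using (hy s hs.1).2) (by simp) t ⟨ht, le_rfl⟩
  simp only [sub_self, abs_zero, add_zero, zero_mul] at this
  exact sub_eq_zero.1 (abs_nonpos_iff.1 this)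

theorem exists_isFluidSolution {α β θ γ : ℝ} (hθ : 0 ≤ θ) (hγ : 0 ≤ γ) (x₀ : ℝ) :
    ∃ x, IsFluidSolution α β θ γ x₀ x := by
  obtain ⟨x, hxc, hx⟩ := exists_continuous_integral_equation
    (F := fun a => (α - β) - θ * max a 0 + γ * max (-a) 0) (K := (θ + γ).toNNReal)
    (LipschitzWith.of_dist_le_mul fun a b => by
      rw [Real.dist_eq, Real.dist_eq, Real.coe_toNNReal _ (by positivity)]
      have h1 := abs_max_sub_max_le_abs a b 0
      have h2 : |max (-a) 0 - max (-b) 0| ≤ |a - b| :=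
        (abs_max_sub_max_le_abs (-a) (-b) 0).trans_eq (by rw [← abs_neg]; ring_nf)
      have h3 : (α - β - θ * max a 0 + γ * max (-a) 0) - (α - β - θ * max b 0 + γ * max (-b) 0)
        = γ * (max (-a) 0 - max (-b) 0) - θ * (max a 0 - max b 0) := by ring
      rw [h3]
      refine (abs_sub _ _).trans ?_
      rw [abs_mul, abs_mul, abs_of_nonneg hθ, abs_of_nonneg hγ]
      nlinarith [mul_le_mul_of_nonneg_left h1 hθ, mul_le_mul_of_nonneg_left h2 hγ]) x₀
  refine ⟨x, fun t ht => ⟨hxc.intervalIntegrable _ _, ?_⟩⟩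
  rw [hx t ht, intervalIntegral.integral_add, intervalIntegral.integral_sub,
    intervalIntegral.integral_const, intervalIntegral.integral_const_mul,
    intervalIntegral.integral_const_mul]
  · simp only [smul_eq_mul]; ring
  all_goals exact Continuous.intervalIntegrable (by fun_prop) _ _

/-- A nonnegative monotone function is close to `c * s` on `[0, T]` as soon as it is close at the
points of an equidistant grid. -/
theorem abs_sub_mul_le_grid {f : ℝ → ℝ} {c T : ℝ} (hc : 0 ≤ c)
    (hf : MonotoneOn f (Set.Icc 0 T)) {m : ℕ} (hm : 0 < m) {s : ℝ} (hs : s ∈ Set.Icc 0 T) :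
    |f s - c * s| ≤ c * (T / m) +
      ∑ j ∈ Finset.range (m + 1), |f (j * (T / m)) - c * (j * (T / m))| := by
  have hT : 0 ≤ T := hs.1.trans hs.2
  have hm' : (0 : ℝ) < m := by exact_mod_cast hm
  have hd : 0 ≤ T / m := by positivity
  have hmem : ∀ j : ℕ, j ≤ m → (j : ℝ) * (T / m) ∈ Set.Icc 0 T := by
    intro j hj
    have : (j : ℝ) ≤ m := by exact_mod_cast hj
    refine ⟨by positivity, ?_⟩
    calc (j : ℝ) * (T / m) ≤ m * (T / m) := by gcongr
      _ = T := by field_simp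
  obtain ⟨j, hj, h1, h2⟩ : ∃ j, j < m ∧ (j : ℝ) * (T / m) ≤ s ∧ s ≤ (j + 1 : ℕ) * (T / m) := by
    by_contra! hcon
    have : ∀ j : ℕ, j ≤ m → (j : ℝ) * (T / m) ≤ s := by
      intro j
      induction j with
      | zero => intro _; simpa using hs.1
      | succ j ih => intro hj; exact (hcon j hj (ih (by omega))).le
    have h3 := hcon (m - 1) (by omega) (this _ (by omega))
    rw [Nat.sub_add_cancel hm] at h3
    have : (m : ℝ) * (T / m) = T := by field_simp
    linarith [hs.2]
  have hle : ∀ i ∈ Finset.range (m + 1), |f (i * (T / m)) - c * (i * (T / m))| ≤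
      ∑ j ∈ Finset.range (m + 1), |f (j * (T / m)) - c * (j * (T / m))| := fun i hi =>
    Finset.single_le_sum (f := fun i : ℕ => |f (i * (T / m)) - c * (i * (T / m))|)
      (fun _ _ => abs_nonneg _) hi
  have g1 := hle j (by simp; omega)
  have g2 := hle (j + 1) (by simp; omega)
  have f1 := hf (hmem j hj.le) hs h1
  have f2 := hf hs (hmem (j + 1) hj) h2
  have a1 := abs_le.1 g1
  have a2 := abs_le.1 g2
  have e : ((j + 1 : ℕ) : ℝ) * (T / m) = j * (T / m) + T / m := by push_cast; ring
  have c1 := mul_le_mul_of_nonneg_left h1 hc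
  have c2 := mul_le_mul_of_nonneg_left h2 hc
  rw [e] at c2 a2 f2
  rw [abs_le]
  constructor <;> nlinarith [a1.1, a1.2, a2.1, a2.2]

/-! ### Domination of a path by its arrivals -/

/-- A path `f` that rises by `a` and by `N` run with the clock `g * ∫ f⁻`, and falls by `d`, is at
most `|f 0| + a + 1`. After the last time at which `f ≤ 0` the clock stands still; since that
last time need not be attained, `N` may still jump there, which costs the additional `1`. -/
theorem path_le_of_unit_jumps {f a d : ℝ → ℝ} {N : ℝ≥0 → ℕ} {g t : ℝ} (ht : 0 ≤ t)
    (hg : 0 ≤ g) (hf : IntervalIntegrable f volume 0 t) (ha : MonotoneOn a (Set.Ici 0))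
    (hd : MonotoneOn d (Set.Ici 0)) (ha0 : 0 ≤ a 0) (hd0 : 0 ≤ d 0)
    (hN0 : N 0 = 0)
    (hjump : ∀ r : ℝ≥0, ∃ b : ℝ, b < r ∧ ∀ r' : ℝ≥0, b < r' → N r ≤ N r' + 1)
    (heq : ∀ s ∈ Set.Icc 0 t, f s = f 0 + a s - d s
      + N (Real.toNNReal (g * ∫ r in (0 : ℝ)..s, max (-f r) 0))) :
    f t ≤ |f 0| + a t + 1 := by
  have hat : 0 ≤ a t := ha0.trans (ha (Set.mem_Ici.2 le_rfl) ht ht)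
  have hneg : IntervalIntegrable (fun r => max (-f r) 0) volume 0 t :=
    hf.neg.max_zero
  have hsub : ∀ {p q}, p ∈ Set.Icc 0 t → q ∈ Set.Icc 0 t →
      IntervalIntegrable (fun r => max (-f r) 0) volume p q := fun hp hq =>
    hneg.mono_set (by
      rw [Set.uIcc_of_le ht]; exact Set.uIcc_subset_Icc hp hq)
  have h0mem : (0 : ℝ) ∈ Set.Icc 0 t := ⟨le_rfl, ht⟩
  have htmem : t ∈ Set.Icc 0 t := ⟨ht, le_rfl⟩
  have hzero : ∀ p ∈ Set.Icc 0 t, (∀ r ∈ Set.Ioc p t, 0 < f r) →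
      ∫ r in p..t, max (-f r) 0 = 0 := by
    intro p hp h
    rw [intervalIntegral.integral_of_le hp.2, setIntegral_congr_fun (g := fun _ => (0 : ℝ))
      measurableSet_Ioc (fun r hr => max_eq_right (by linarith [h r hr]))]
    simp
  set S : Set ℝ := {s | s ∈ Set.Icc 0 t ∧ f s ≤ 0} with hS
  rcases S.eq_empty_or_nonempty with hSe | hSn
  · have hpos : ∀ r ∈ Set.Icc 0 t, 0 < f r := fun r hr => by
      by_contra! hcon
      exact (Set.eq_empty_iff_forall_notMem.1 hSe r) ⟨hr, hcon⟩
    have h1 := heq t htmem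
    rw [hzero 0 h0mem fun r hr => hpos r ⟨hr.1.le, hr.2⟩] at h1
    have h2 : 0 ≤ d t := hd0.trans (hd (Set.mem_Ici.2 le_rfl) ht ht)
    simp only [mul_zero, Real.toNNReal_zero, hN0, Nat.cast_zero] at h1
    linarith [le_abs_self (f 0)]
  · have hSb : BddAbove S := ⟨t, fun s hs => hs.1.2⟩
    set τ := sSup S
    have hτ : τ ∈ Set.Icc 0 t := by
      obtain ⟨s, hs⟩ := hSn
      exact ⟨hs.1.1.trans (le_csSup hSb hs), csSup_le ⟨s, hs⟩ fun s hs => hs.1.2⟩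
    set B : ℝ → ℝ := fun s => g * ∫ r in (0 : ℝ)..s, max (-f r) 0 with hB
    have hBτ : B τ = B t := by
      have h1 := intervalIntegral.integral_add_adjacent_intervals (hsub h0mem hτ) (hsub hτ htmem)
      rw [hzero τ hτ fun r hr => by
        by_contra! hcon
        exact (not_le.2 hr.1) (le_csSup hSb ⟨⟨hτ.1.trans hr.1.le, hr.2⟩, hcon⟩)] at h1
      simp only [hB, ← h1, add_zero]
    have hB0 : 0 ≤ B t := mul_nonneg hg (intervalIntegral.integral_nonneg ht fun r _ =>
      le_max_right _ _)
    obtain ⟨b, hb, hbN⟩ := hjump (Real.toNNReal (B t))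
    rw [Real.coe_toNNReal _ hB0, ← hBτ] at hb
    have hcont : ContinuousOn B (Set.Icc 0 t) := by
      have := intervalIntegral.continuousOn_primitive_interval' hneg
        (a := 0) (by rw [Set.uIcc_of_le ht]; exact h0mem)
      rw [Set.uIcc_of_le ht] at this
      exact continuousOn_const.mul this
    obtain ⟨δ, hδ, hδB⟩ := Metric.mem_nhdsWithin_iff.1
      ((hcont τ hτ).preimage_mem_nhdsWithin (Ioi_mem_nhds hb))
    -- a time `s` with `f s ≤ 0`, so close to `τ` that `N` jumps at most by `1` between the clock
    -- readings at `s` and at `τ`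
    obtain ⟨s, hs, hsτ⟩ := exists_lt_of_lt_csSup hSn (sub_lt_self τ hδ)
    have hsle : s ≤ τ := le_csSup hSb hs
    have hBs : b < B s := hδB ⟨by
      rw [Metric.mem_ball, Real.dist_eq, abs_lt]; constructor <;> linarith, hs.1⟩
    have hN1 := hbN (Real.toNNReal (B s)) (hBs.trans_le (Real.le_coe_toNNReal _))
    have hN2 : (N (Real.toNNReal (B t)) : ℝ) ≤ N (Real.toNNReal (B s)) + 1 := by
      exact_mod_cast hN1
    have e1 := heq t htmem
    have e2 := heq s hs.1
    have m1 := ha (Set.mem_Ici.2 le_rfl) hs.1.1 hs.1.1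
    have m2 := hd hs.1.1 ht hs.1.2
    have := hs.2
    simp only [hB] at hN2
    linarith [abs_nonneg (f 0)]

/-! ### Poisson processes -/

theorem hasSum_sq_sub_poisson (r : ℝ≥0) :
    HasSum (fun n : ℕ => (Real.exp (-r) * r ^ n / n.factorial) * ((n : ℝ) - r) ^ 2) r := by
  have h0 := hasSum_one_poissonMeasure r
  have h1 : HasSum (fun n : ℕ => (Real.exp (-r) * r ^ n / n.factorial) * n) (r : ℝ) := by
    rw [← hasSum_nat_add_iff' 1]
    simp only [Finset.range_one, Finset.sum_singleton, Nat.cast_zero, mul_zero, sub_zero]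
    have := h0.mul_left (r : ℝ)
    rw [mul_one] at this
    refine this.congr_fun fun n => ?_
    rw [Nat.factorial_succ]
    push_cast
    field_simp
    ring
  have h2 : HasSum (fun n : ℕ => (Real.exp (-r) * r ^ n / n.factorial) * (n * (n - 1)))
      ((r : ℝ) ^ 2) := by
    rw [← hasSum_nat_add_iff' 2]
    simp only [Finset.sum_range_succ, Finset.range_zero, Finset.sum_empty, Nat.cast_zero,
      zero_mul, mul_zero, Nat.cast_one, sub_self, add_zero, sub_zero]
    have := h0.mul_left ((r : ℝ) ^ 2)
    rw [mul_one] at this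
    refine this.congr_fun fun n => ?_
    rw [show n + 2 = (n + 1) + 1 from rfl, Nat.factorial_succ, Nat.factorial_succ]
    push_cast
    field_simp
    ring
  -- `(n - r)² = n (n - 1) + (1 - 2 r) n + r²`
  have h3 := (h2.add (h1.mul_left (1 - 2 * (r : ℝ)))).add (h0.mul_left ((r : ℝ) ^ 2))
  convert h3 using 1
  · funext n; ring
  · ring

theorem lintegral_sq_sub_poissonMeasure (r : ℝ≥0) :
    ∫⁻ n, ENNReal.ofReal (((n : ℝ) - r) ^ 2) ∂(poissonMeasure r) = r := by
  rw [lintegral_countable']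
  simp_rw [poissonMeasure_singleton]
  have h := hasSum_sq_sub_poisson r
  have h' := congrArg ENNReal.ofReal h.tsum_eq
  rw [ENNReal.ofReal_tsum_of_nonneg (fun n => by positivity) h.summable,
    ENNReal.ofReal_coe_nnreal] at h'
  rw [← h']
  refine tsum_congr fun n => ?_
  rw [← ENNReal.ofReal_mul (by positivity), mul_comm]

theorem poissonMeasure_two_le (r : ℝ≥0) :
    poissonMeasure r {n | 2 ≤ n} ≤ ENNReal.ofReal ((r : ℝ) ^ 2) := by
  have h1 : ({n | 2 ≤ n} : Set ℕ) = ({0} ∪ {1} : Set ℕ)ᶜ := by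
    ext n; simp; omega
  have h2 : (poissonMeasure r).real {n | 2 ≤ n} = 1 - Real.exp (-r) * (1 + r) := by
    rw [h1, measureReal_compl (MeasurableSet.of_discrete), measureReal_union (by simp)
      (MeasurableSet.of_discrete), poissonMeasure_real_singleton, poissonMeasure_real_singleton]
    simp
    ring
  rw [← ofReal_measureReal, h2]
  apply ENNReal.ofReal_le_ofReal
  have h3 : 1 - (r : ℝ) ≤ Real.exp (-r) := by
    have := Real.add_one_le_exp (-(r : ℝ)); linarith
  nlinarith [r.coe_nonneg]

section Poisson

variable {Ω : Type*} [MeasurableSpace Ω] {P : Measure Ω} {N : ℝ≥0 → Ω → ℕ}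

/-- From `Var (N r) = r` and `|y| ≤ y ^ 2 / a + a`. The form linear in `r` makes it possible to
substitute a random horizon of which only the mean is controlled. -/
theorem IsUnitPoissonProcess.lintegral_abs_sub_le [IsProbabilityMeasure P]
    (hN : IsUnitPoissonProcess P N) (r : ℝ≥0)
    {a : ℝ} (ha : 0 < a) :
    ∫⁻ ω, ENNReal.ofReal |(N r ω : ℝ) - r| ∂P ≤ ENNReal.ofReal (r / a + a) := by
  have hlaw := hN.law_increments 0 r bot_le
  rw [tsub_zero] at hlaw
  have h1 : ∫⁻ ω, ENNReal.ofReal (((N r ω : ℝ) - r) ^ 2) ∂P = r := by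
    rw [← lintegral_sq_sub_poissonMeasure, ← hlaw.lintegral_comp (by fun_prop)]
    refine lintegral_congr_ae ?_
    filter_upwards [hN.zero] with ω hω
    rw [hω, Nat.sub_zero]
  calc _ ≤ ∫⁻ ω, (ENNReal.ofReal (1 / a) * ENNReal.ofReal (((N r ω : ℝ) - r) ^ 2)
        + ENNReal.ofReal a) ∂P := by
        refine lintegral_mono fun ω => ?_
        rw [← ENNReal.ofReal_mul (by positivity), ← ENNReal.ofReal_add (by positivity) ha.le]
        apply ENNReal.ofReal_le_ofReal
        set y := (N r ω : ℝ) - r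
        have : |y| * a ≤ |y| ^ 2 + a * a := by nlinarith [sq_nonneg (|y| - a)]
        rw [← sq_abs y]
        calc |y| = |y| * a / a := by field_simp
          _ ≤ (|y| ^ 2 + a * a) / a := by gcongr
          _ = _ := by field_simp
    _ = _ := by
        have hm := hN.measurable r
        rw [lintegral_add_right _ measurable_const, lintegral_const_mul _ (by fun_prop), h1,
          lintegral_const, measure_univ, mul_one, ENNReal.ofReal_add (by positivity) ha.le,
          ← ENNReal.ofReal_coe_nnreal, ← ENNReal.ofReal_mul (by positivity)]
        congr 2
        ring

/-- A cell of width `T / m` sees two or more points with probability at most `(T / m) ^ 2`, so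
the probability that some cell does is at most `T ^ 2 / m`, which tends to `0`. -/
theorem IsUnitPoissonProcess.ae_grid_increment_le_one (hN : IsUnitPoissonProcess P N) (T : ℝ≥0) :
    ∀ᵐ ω ∂P, ∃ m : ℕ, 0 < m ∧ ∀ i < m,
      N ((i + 1 : ℕ) * (T / m)) ω ≤ N (i * (T / m)) ω + 1 := by
  have hbad : ∀ m : ℕ, 0 < m → P {ω | ¬ ∃ m : ℕ, 0 < m ∧ ∀ i < m,
      N ((i + 1 : ℕ) * (T / m)) ω ≤ N (i * (T / m)) ω + 1} ≤ ENNReal.ofReal ((T : ℝ) ^ 2 / m) := by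
    intro m hm
    have hm' : (0 : ℝ) < m := by exact_mod_cast hm
    calc _ ≤ P (⋃ i ∈ Finset.range m,
          {ω | 2 ≤ N ((i + 1 : ℕ) * (T / m)) ω - N (i * (T / m)) ω}) := by
          refine measure_mono fun ω hω => ?_
          simp only [Set.mem_ofPred_eq, not_exists, not_and, not_forall, not_le] at hω
          obtain ⟨i, hi, h⟩ := hω m hm
          simp only [Set.mem_iUnion, Finset.mem_range, Set.mem_ofPred_eq]
          exact ⟨i, hi, by omega⟩
      _ ≤ ∑ i ∈ Finset.range m,
          P {ω | 2 ≤ N ((i + 1 : ℕ) * (T / m)) ω - N (i * (T / m)) ω} :=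
          measure_biUnion_finset_le _ _
      _ ≤ ∑ i ∈ Finset.range m, ENNReal.ofReal (((T / m : ℝ≥0) : ℝ) ^ 2) := by
          refine Finset.sum_le_sum fun i _ => ?_
          have hle : (i : ℝ≥0) * (T / m) ≤ (i + 1 : ℕ) * (T / m) := by
            gcongr; simp
          have h1 := hN.law_increments _ _ hle
          have h2 : ((i + 1 : ℕ) : ℝ≥0) * (T / m) - i * (T / m) = T / m := by
            rw [← tsub_mul]; simp
          rw [h2] at h1
          rw [h1.measure_eq (p := fun n => 2 ≤ n) MeasurableSet.of_discrete]
          exact poissonMeasure_two_le _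
      _ = _ := by
          rw [Finset.sum_const, Finset.card_range, nsmul_eq_mul, ← ENNReal.ofReal_natCast,
            ← ENNReal.ofReal_mul (by positivity)]
          congr 1
          push_cast
          field_simp
  have hlim : Tendsto (fun m : ℕ => ENNReal.ofReal ((T : ℝ) ^ 2 / m)) atTop (𝓝 0) := by
    simpa using ENNReal.tendsto_ofReal (tendsto_const_div_atTop_nhds_zero_nat ((T : ℝ) ^ 2))
  refine le_antisymm (ge_of_tendsto hlim ?_) bot_le
  filter_upwards [eventually_gt_atTop 0] with m hm using hbad m hm

/-- Almost surely all jumps have size at most `1`. The real number `b` is a time before `r`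
(negative if `r = 0`) from which on the path is within `1` of its value at `r`. -/
theorem IsUnitPoissonProcess.ae_unit_jumps (hN : IsUnitPoissonProcess P N) :
    ∀ᵐ ω ∂P, ∀ r : ℝ≥0, ∃ b : ℝ, b < r ∧ ∀ r' : ℝ≥0, b < r' → N r ω ≤ N r' ω + 1 := by
  filter_upwards [hN.mono, ae_all_iff.2 fun T : ℕ => hN.ae_grid_increment_le_one (T : ℝ≥0)]
    with ω hmono hgrid r
  rcases eq_or_ne r 0 with rfl | hr
  · exact ⟨-1, by simp, fun r' _ => (hmono bot_le).trans (Nat.le_succ _)⟩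
  obtain ⟨T, hT⟩ := exists_nat_ge r
  obtain ⟨m, hm, h⟩ := hgrid T
  have hr0 : 0 < r := pos_iff_ne_zero.2 hr
  have hT0 : (0 : ℝ≥0) < T := hr0.trans_le hT
  have hm0 : (0 : ℝ≥0) < m := by exact_mod_cast hm
  have hex : ∃ i : ℕ, r ≤ (i : ℝ≥0) * (T / m) := ⟨m, by
    rw [mul_div_cancel₀ _ hm0.ne']; exact hT⟩
  classical
  have hspec := Nat.find_spec hex
  obtain ⟨i, hi⟩ : ∃ i, Nat.find hex = i + 1 := Nat.exists_eq_succ_of_ne_zero fun h0 => by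
    rw [h0] at hspec
    simp at hspec
    exact hr hspec
  have hlt : (i : ℝ≥0) * (T / m) < r := not_le.1 (Nat.find_min hex (by omega))
  have him : i < m := by
    have : Nat.find hex ≤ m := Nat.find_min' hex (by rw [mul_div_cancel₀ _ hm0.ne']; exact hT)
    omega
  rw [hi] at hspec
  refine ⟨((i * (T / m) : ℝ≥0) : ℝ), by exact_mod_cast hlt, fun r' hr' => ?_⟩
  exact (hmono hspec).trans ((h i him).trans (Nat.add_le_add_right
    (hmono (by exact_mod_cast hr'.le)) 1))

/-- A bound in mean for each fixed `k` may be evaluated at an independent random index `κ`. -/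
theorem lintegral_comp_le_of_indepFun {κ : Ω → ℕ} {f : ℕ → Ω → ℝ≥0∞} {g : ℕ → ℝ≥0∞}
    (hκ : Measurable κ) (hf : ∀ k, Measurable (f k)) (hind : ∀ k, IndepFun κ (f k) P)
    (hfg : ∀ k, ∫⁻ ω, f k ω ∂P ≤ g k) :
    ∫⁻ ω, f (κ ω) ω ∂P ≤ ∫⁻ ω, g (κ ω) ∂P := by
  -- `δ k (κ ω)` is the indicator of `κ ω = k`
  let δ : ℕ → ℕ → ℝ≥0∞ := fun k => Set.indicator {k} 1
  have hδ : ∀ h : ℕ → ℝ≥0∞, ∀ l, h l = ∑' k, δ k l * h k := by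
    intro h l
    rw [tsum_eq_single l fun k hk => by simp [δ, hk.symm]]
    simp [δ]
  have hδm : ∀ k, Measurable fun ω => δ k (κ ω) := fun k =>
    (measurable_of_countable (δ k)).comp hκ
  calc ∫⁻ ω, f (κ ω) ω ∂P = ∫⁻ ω, ∑' k, δ k (κ ω) * f k ω ∂P :=
        lintegral_congr fun ω => hδ (fun k => f k ω) (κ ω)
    _ = ∑' k, (∫⁻ ω, δ k (κ ω) ∂P) * ∫⁻ ω, f k ω ∂P := by
        rw [lintegral_tsum (f := fun k ω => δ k (κ ω) * f k ω)
          fun k => ((hδm k).mul (hf k)).aemeasurable]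
        refine tsum_congr fun k => ?_
        exact lintegral_mul_eq_lintegral_mul_lintegral_of_indepFun (hδm k) (hf k)
          ((hind k).comp (measurable_of_countable (δ k)) measurable_id)
    _ ≤ ∑' k, (∫⁻ ω, δ k (κ ω) ∂P) * g k := by gcongr with k; exact hfg k
    _ = ∫⁻ ω, ∑' k, δ k (κ ω) * g k ∂P := by
        rw [lintegral_tsum fun k => ((hδm k).mul_const _).aemeasurable]
        exact tsum_congr fun k => (lintegral_mul_const _ (hδm k)).symm
    _ = _ := lintegral_congr fun ω => (hδ g (κ ω)).symm

/-- An upper bound for `|N r - r|`, uniform over `r ∈ [0, h]`, built from an equidistant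
grid with `m` cells. -/
noncomputable def gridError (N : ℝ≥0 → Ω → ℕ) (m : ℕ) (h : ℝ) (ω : Ω) : ℝ :=
  h / m + ∑ j ∈ Finset.range (m + 1),
    |(N (Real.toNNReal (j * (h / m))) ω : ℝ) - j * (h / m)|

omit [MeasurableSpace Ω] in
theorem abs_sub_le_gridError {m : ℕ} (hm : 0 < m) {h r : ℝ} {ω : Ω}
    (hmono : Monotone fun t => N t ω) (hr : r ∈ Set.Icc 0 h) :
    |(N (Real.toNNReal r) ω : ℝ) - r| ≤ gridError N m h ω := by
  have := abs_sub_mul_le_grid (f := fun r => (N (Real.toNNReal r) ω : ℝ)) (c := 1) zero_le_one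
    (fun a _ b _ hab => by
      simp only
      exact_mod_cast hmono (Real.toNNReal_le_toNNReal hab)) hm hr
  simpa only [one_mul, gridError] using this

theorem measurable_abs_sub_random_time (hmeas : ∀ r, Measurable (N r)) {κ : Ω → ℕ}
    (hκ : Measurable κ) (j : ℕ) (c : ℝ) (m : ℕ) :
    Measurable fun ω => ENNReal.ofReal
      |(N (Real.toNNReal (j * (c * κ ω / m))) ω : ℝ) - j * (c * κ ω / m)| := by
  have h1 : Measurable fun p : ℕ × Ω => ENNReal.ofReal
      |(N (Real.toNNReal (j * (c * p.1 / m))) p.2 : ℝ) - j * (c * p.1 / m)| :=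
    measurable_from_prod_countable_right fun k => by dsimp only; fun_prop
  have hpair : Measurable fun ω => (κ ω, ω) := hκ.prodMk measurable_id'
  have h2 := h1.comp hpair
  exact h2

theorem measurable_gridError (hmeas : ∀ r, Measurable (N r)) {κ : Ω → ℕ}
    (hκ : Measurable κ) (c : ℝ) (m : ℕ) : Measurable fun ω => gridError N m (c * κ ω) ω := by
  have h1 : Measurable fun p : ℕ × Ω => gridError N m (c * p.1) p.2 :=
    measurable_from_prod_countable_right fun k => by
      dsimp only [gridError]
      fun_prop
  have hpair : Measurable fun ω => (κ ω, ω) := hκ.prodMk measurable_id'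
  have h2 := h1.comp hpair
  exact h2

theorem IsUnitPoissonProcess.lintegral_abs_sub_random_time_le [IsProbabilityMeasure P]
    (hN : IsUnitPoissonProcess P N)
    {κ : Ω → ℕ} (hκ : Measurable κ) (hind : ∀ r, IndepFun κ (N r) P) {c a : ℝ} (hc : 0 ≤ c)
    (ha : 0 < a) {m : ℕ} (hm : 0 < m) {j : ℕ} (hj : j ≤ m) :
    ∫⁻ ω, ENNReal.ofReal
      |(N (Real.toNNReal (j * (c * κ ω / m))) ω : ℝ) - j * (c * κ ω / m)| ∂P ≤
      ENNReal.ofReal (c / a) * ∫⁻ ω, κ ω ∂P + ENNReal.ofReal a := by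
  have hm' : (0 : ℝ) < m := by exact_mod_cast hm
  have hκm : Measurable fun ω => (κ ω : ℝ≥0∞) := (measurable_of_countable _).comp hκ
  have hj' : (j : ℝ) ≤ m := by exact_mod_cast hj
  have hmeas := fun r => hN.measurable r
  refine (lintegral_comp_le_of_indepFun (P := P) (κ := κ)
    (f := fun k ω => ENNReal.ofReal
      |(N (Real.toNNReal (j * (c * k / m))) ω : ℝ) - j * (c * k / m)|)
    (g := fun k => ENNReal.ofReal (c / a) * k + ENNReal.ofReal a) hκ
    (fun k => by fun_prop)
    (fun k => (hind (Real.toNNReal (j * (c * k / m)))).comp (φ := id)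
      (ψ := fun n : ℕ => ENNReal.ofReal |(n : ℝ) - j * (c * k / m)|) measurable_id
      (measurable_of_countable _)) ?_).trans_eq ?_
  · intro k
    have h0 : (0 : ℝ) ≤ j * (c * k / m) := by positivity
    have h1 := hN.lintegral_abs_sub_le (Real.toNNReal (j * (c * k / m))) ha
    rw [Real.coe_toNNReal _ h0] at h1
    refine h1.trans ?_
    rw [← ENNReal.ofReal_natCast k, ← ENNReal.ofReal_mul (by positivity),
      ← ENNReal.ofReal_add (by positivity) ha.le]
    apply ENNReal.ofReal_le_ofReal
    have : j * (c * k / m) ≤ c * k :=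
      calc j * (c * k / m) ≤ m * (c * k / m) := by gcongr
        _ = c * k := by field_simp
    calc _ ≤ c * k / a + a := by gcongr
      _ = _ := by ring
  · rw [lintegral_add_right _ measurable_const, lintegral_const_mul _ hκm, lintegral_const,
      measure_univ, mul_one]

/-- The expected deviation of a Poisson process from its mean, uniformly up to an independent
random horizon `c * κ`. -/
theorem IsUnitPoissonProcess.lintegral_gridError_le [IsProbabilityMeasure P]
    (hN : IsUnitPoissonProcess P N)
    {κ : Ω → ℕ} (hκ : Measurable κ) (hind : ∀ r, IndepFun κ (N r) P) {c a : ℝ} (hc : 0 ≤ c)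
    (ha : 0 < a) {m : ℕ} (hm : 0 < m) :
    ∫⁻ ω, ENNReal.ofReal (gridError N m (c * κ ω) ω) ∂P ≤
      ENNReal.ofReal (c / m + (m + 1) * (c / a)) * ∫⁻ ω, κ ω ∂P
        + ENNReal.ofReal ((m + 1) * a) := by
  have hm' : (0 : ℝ) < m := by exact_mod_cast hm
  have hκm : Measurable fun ω => (κ ω : ℝ≥0∞) := (measurable_of_countable _).comp hκ
  have hle : ∀ j ∈ Finset.range (m + 1), ∫⁻ ω, ENNReal.ofReal
      |(N (Real.toNNReal (j * (c * κ ω / m))) ω : ℝ) - j * (c * κ ω / m)| ∂P ≤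
      ENNReal.ofReal (c / a) * ∫⁻ ω, κ ω ∂P + ENNReal.ofReal a := fun j hj =>
    hN.lintegral_abs_sub_random_time_le hκ hind hc ha hm (Finset.mem_range_succ_iff.1 hj)
  have hjm := fun j : ℕ => measurable_abs_sub_random_time hN.measurable hκ j c m
  have hexp : ∀ F : ℕ → Ω → ℝ≥0∞, (∀ j, Measurable (F j)) →
      ∫⁻ ω, (ENNReal.ofReal (c / m) * κ ω + ∑ j ∈ Finset.range (m + 1), F j ω) ∂P =
      ENNReal.ofReal (c / m) * ∫⁻ ω, κ ω ∂P + ∑ j ∈ Finset.range (m + 1), ∫⁻ ω, F j ω ∂P := by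
    intro F hF
    rw [lintegral_add_left (hκm.const_mul _), lintegral_const_mul _ hκm,
      lintegral_finsetSum _ fun j _ => hF j]
  calc _ = ∫⁻ ω, (ENNReal.ofReal (c / m) * κ ω + ∑ j ∈ Finset.range (m + 1), ENNReal.ofReal
          |(N (Real.toNNReal (j * (c * κ ω / m))) ω : ℝ) - j * (c * κ ω / m)|) ∂P := by
        refine lintegral_congr fun ω => ?_
        rw [gridError, ENNReal.ofReal_add (by positivity)
          (Finset.sum_nonneg fun _ _ => abs_nonneg _),
          ENNReal.ofReal_sum_of_nonneg fun _ _ => abs_nonneg _,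
          ← ENNReal.ofReal_natCast (κ ω), ← ENNReal.ofReal_mul (by positivity)]
        congr 2
        ring
    _ = ENNReal.ofReal (c / m) * ∫⁻ ω, κ ω ∂P + ∑ j ∈ Finset.range (m + 1), ∫⁻ ω, ENNReal.ofReal
          |(N (Real.toNNReal (j * (c * κ ω / m))) ω : ℝ) - j * (c * κ ω / m)| ∂P := by
        exact hexp (fun j ω => ENNReal.ofReal
          |(N (Real.toNNReal (j * (c * κ ω / m))) ω : ℝ) - j * (c * κ ω / m)|) hjm
    _ ≤ ENNReal.ofReal (c / m) * ∫⁻ ω, κ ω ∂P + ∑ j ∈ Finset.range (m + 1),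
          (ENNReal.ofReal (c / a) * ∫⁻ ω, κ ω ∂P + ENNReal.ofReal a) := by
        gcongr with j hj
        exact hle j hj
    _ = _ := by
        rw [Finset.sum_const, Finset.card_range, nsmul_eq_mul,
          ENNReal.ofReal_add (by positivity) (by positivity), ENNReal.ofReal_mul (by positivity),
          ENNReal.ofReal_mul (by positivity)]
        have : ENNReal.ofReal ((m : ℝ) + 1) = ((m + 1 : ℕ) : ℝ≥0∞) := by
          rw [← ENNReal.ofReal_natCast]; push_cast; rfl
        rw [this]
        ring

end Poisson

/-! ### Renewal processes -/

theorem measurable_renewalCount {Ω : Type*} [MeasurableSpace Ω] {U : ℕ → Ω → ℝ}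
    (hU : ∀ k, Measurable (U k)) (t : ℝ) : Measurable (renewalCount U t) := by
  classical
  have h1 : renewalCount U t =
      fun ω => ⨆ k : ℕ, if ∑ i ∈ Finset.range k, U i ω ≤ t then k else 0 := by
    funext ω
    rw [renewalCount, iSup]
    rcases Set.eq_empty_or_nonempty {k : ℕ | ∑ i ∈ Finset.range k, U i ω ≤ t} with he | ⟨k₀, hk₀⟩
    · rw [he]
      have : ∀ k : ℕ, ¬ ∑ i ∈ Finset.range k, U i ω ≤ t := fun k =>
        Set.eq_empty_iff_forall_notMem.1 he k
      simp [this]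
    · set A := {k : ℕ | ∑ i ∈ Finset.range k, U i ω ≤ t}
      have hsub : A ⊆ Set.range fun k : ℕ => if ∑ i ∈ Finset.range k, U i ω ≤ t then k else 0 :=
        fun k hk => ⟨k, if_pos hk⟩
      have hsup : (Set.range fun k : ℕ => if ∑ i ∈ Finset.range k, U i ω ≤ t then k else 0)
          ⊆ insert 0 A := by
        rintro _ ⟨k, rfl⟩
        dsimp only
        split_ifs with h
        · exact Or.inr h
        · exact Or.inl rfl
      by_cases hb : BddAbove A
      · have hb' := (hb.insert 0).mono hsup
        refine le_antisymm (csSup_le_csSup hb' ⟨k₀, hk₀⟩ hsub) (csSup_le ⟨_, 0, rfl⟩ ?_)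
        intro n hn
        rcases hsup hn with h | h
        · rw [h]; exact Nat.zero_le _
        · exact le_csSup hb h
      · rw [Nat.sSup_of_not_bddAbove hb, Nat.sSup_of_not_bddAbove fun h => hb (h.mono hsub)]
  rw [h1]
  refine Measurable.iSup fun k => Measurable.ite ?_ measurable_const measurable_const
  exact measurableSet_le (Finset.measurable_fun_sum _ fun i _ => hU i) measurable_const

section Path

variable {Ω : Type*} {U : ℕ → Ω → ℝ} {ω : Ω}

/-- The divergence of the partial sums guarantees that the supremum defining `renewalCount` is
over a bounded set and hence attained. -/
theorem le_renewalCount_iff (hpos : ∀ k, 0 < U k ω)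
    (hlim : Tendsto (fun k => ∑ i ∈ Finset.range k, U i ω) atTop atTop) {t : ℝ} (ht : 0 ≤ t)
    (k : ℕ) : k ≤ renewalCount U t ω ↔ ∑ i ∈ Finset.range k, U i ω ≤ t := by
  have hmono : Monotone fun k => ∑ i ∈ Finset.range k, U i ω := monotone_nat_of_le_succ fun k => by
    rw [Finset.sum_range_succ]
    linarith [hpos k]
  have hbdd : BddAbove {k : ℕ | ∑ i ∈ Finset.range k, U i ω ≤ t} := by
    obtain ⟨K, hK⟩ := (hlim.eventually_gt_atTop t).exists
    refine ⟨K, fun k hk => ?_⟩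
    by_contra! hcon
    exact absurd (hmono hcon.le) (not_le.2 (lt_of_le_of_lt hk hK))
  refine ⟨fun h => (hmono h).trans ?_, fun h => le_csSup hbdd h⟩
  exact Nat.sSup_mem ⟨0, by simpa using ht⟩ hbdd

theorem monotoneOn_renewalCount (hpos : ∀ k, 0 < U k ω)
    (hlim : Tendsto (fun k => ∑ i ∈ Finset.range k, U i ω) atTop atTop) :
    MonotoneOn (fun t => renewalCount U t ω) (Set.Ici 0) := fun s hs t ht hst => by
  dsimp only
  rw [le_renewalCount_iff hpos hlim ht]
  exact ((le_renewalCount_iff hpos hlim hs _).1 le_rfl).trans hst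

/-- Exponential Markov inequality, summed over the arrivals after the `k₀`-th. -/
theorem ofReal_renewalCount_sub_le (hpos : ∀ k, 0 < U k ω)
    (hlim : Tendsto (fun k => ∑ i ∈ Finset.range k, U i ω) atTop atTop) {t c : ℝ} (ht : 0 ≤ t)
    (hc : 0 ≤ c) (k₀ : ℕ) :
    ENNReal.ofReal (renewalCount U t ω - k₀) ≤
      ∑' k : ℕ, ENNReal.ofReal
        (Real.exp (c * (t - ∑ i ∈ Finset.range (k₀ + 1 + k), U i ω))) := by
  calc ENNReal.ofReal (renewalCount U t ω - k₀)
      ≤ ((renewalCount U t ω - k₀ : ℕ) : ℝ≥0∞) := by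
        rw [← ENNReal.ofReal_natCast]
        refine ENNReal.ofReal_le_ofReal ?_
        rw [sub_le_iff_le_add]
        exact_mod_cast (by omega : renewalCount U t ω ≤ renewalCount U t ω - k₀ + k₀)
    _ = ∑ k ∈ Finset.range (renewalCount U t ω - k₀), 1 := by simp
    _ ≤ ∑ k ∈ Finset.range (renewalCount U t ω - k₀), ENNReal.ofReal
        (Real.exp (c * (t - ∑ i ∈ Finset.range (k₀ + 1 + k), U i ω))) := by
        refine Finset.sum_le_sum fun k hk => ?_
        rw [ENNReal.one_le_ofReal]
        have hk' := Finset.mem_range.1 hk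
        have := (le_renewalCount_iff hpos hlim ht (k₀ + 1 + k)).1 (by omega)
        exact Real.one_le_exp (mul_nonneg hc (by linarith))
    _ ≤ _ := ENNReal.sum_le_tsum _

/-- Chebyshev's inequality, summed over the first `k₀` arrivals, all of which are expected before
time `t - δ`. -/
theorem ofReal_sub_renewalCount_le (hpos : ∀ k, 0 < U k ω)
    (hlim : Tendsto (fun k => ∑ i ∈ Finset.range k, U i ω) atTop atTop) {t δ μ : ℝ} (ht : 0 ≤ t)
    (hδ : 0 < δ) (k₀ : ℕ) (hk₀ : ∀ k : ℕ, k ≤ k₀ → k * μ ≤ t - δ) :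
    ENNReal.ofReal (k₀ - renewalCount U t ω) ≤
      ∑ k ∈ Finset.range k₀, ENNReal.ofReal
        ((∑ i ∈ Finset.range (k + 1), U i ω - (k + 1 : ℕ) * μ) ^ 2 / δ ^ 2) := by
  calc ENNReal.ofReal (k₀ - renewalCount U t ω)
      ≤ ((k₀ - renewalCount U t ω : ℕ) : ℝ≥0∞) := by
        rw [← ENNReal.ofReal_natCast]
        refine ENNReal.ofReal_le_ofReal ?_
        rw [sub_le_iff_le_add]
        exact_mod_cast (by omega : k₀ ≤ k₀ - renewalCount U t ω + renewalCount U t ω)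
    _ = ∑ k ∈ Finset.Ico (renewalCount U t ω) k₀, 1 := by simp
    _ ≤ ∑ k ∈ Finset.Ico (renewalCount U t ω) k₀, ENNReal.ofReal
        ((∑ i ∈ Finset.range (k + 1), U i ω - (k + 1 : ℕ) * μ) ^ 2 / δ ^ 2) := by
        refine Finset.sum_le_sum fun k hk => ?_
        obtain ⟨h1, h2⟩ := Finset.mem_Ico.1 hk
        have h3 := (le_renewalCount_iff hpos hlim ht (k + 1)).not.1 (by omega)
        have h4 := hk₀ (k + 1) (by omega)
        rw [ENNReal.one_le_ofReal, one_le_div (by positivity)]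
        exact pow_le_pow_left₀ hδ.le (by linarith) 2
    _ ≤ _ := Finset.sum_le_sum_of_subset fun k hk =>
        Finset.mem_range.2 (Finset.mem_Ico.1 hk).2

end Path

theorem exp_neg_le_quadratic {x : ℝ} (hx : 0 ≤ x) : Real.exp (-x) ≤ 1 - x + x ^ 2 / 2 := by
  have h1 := Real.quadratic_le_exp_of_nonneg hx
  have h2 : Real.exp (-x) * Real.exp x = 1 := by rw [← Real.exp_add]; simp
  have h3 := Real.exp_pos (-x)
  have h4 : Real.exp (-x) * (1 + x + x ^ 2 / 2) ≤ 1 := by nlinarith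
  have h5 : 1 ≤ (1 - x + x ^ 2 / 2) * (1 + x + x ^ 2 / 2) := by nlinarith [sq_nonneg (x ^ 2)]
  have h6 : 0 < 1 + x + x ^ 2 / 2 := by positivity
  exact le_of_mul_le_mul_right (h4.trans h5) h6

section Renewal

variable {Ω : Type*} [MeasurableSpace Ω] {P : Measure Ω} [IsProbabilityMeasure P]
  {U : ℕ → Ω → ℝ} {α σ : ℝ}

omit [IsProbabilityMeasure P] in
theorem IsInterarrivalSequence.ae_pos (hU : IsInterarrivalSequence P U α σ) :
    ∀ᵐ ω ∂P, ∀ k, 0 < U k ω :=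
  ae_all_iff.2 fun k => (hU.identDistrib k).symm.ae_snd (p := fun x => 0 < x)
    measurableSet_Ioi hU.pos

omit [IsProbabilityMeasure P] in
theorem IsInterarrivalSequence.memLp_apply (hU : IsInterarrivalSequence P U α σ) (k : ℕ) :
    MemLp (U k) 2 P := (hU.identDistrib k).symm.memLp_snd hU.memLp

theorem IsInterarrivalSequence.ae_tendsto_sum (hU : IsInterarrivalSequence P U α σ) :
    ∀ᵐ ω ∂P, Tendsto (fun k => ∑ i ∈ Finset.range k, U i ω) atTop atTop := by
  filter_upwards [strong_law_ae_real U (hU.memLp.integrable one_le_two)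
    (fun i j hij => hU.indep.indepFun hij) hU.identDistrib] with ω hω
  rw [hU.mean] at hω
  have h1 := hω.pos_mul_atTop (one_div_pos.2 hU.rate_pos) tendsto_natCast_atTop_atTop
  refine h1.congr' ?_
  filter_upwards [eventually_gt_atTop 0] with k hk
  have : (k : ℝ) ≠ 0 := by exact_mod_cast hk.ne'
  field_simp

theorem IsInterarrivalSequence.lintegral_sq_sum_sub (hU : IsInterarrivalSequence P U α σ)
    (k : ℕ) : ∫⁻ ω, ENNReal.ofReal ((∑ i ∈ Finset.range k, U i ω - k * (1 / α)) ^ 2) ∂P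
      = ENNReal.ofReal (k * σ ^ 2) := by
  have hm := hU.memLp_apply
  have hL : MemLp (∑ i ∈ Finset.range k, U i) 2 P := memLp_finsetSum' _ fun i _ => hm i
  have hvar : Var[∑ i ∈ Finset.range k, U i; P] = k * σ ^ 2 := by
    rw [IndepFun.variance_sum (fun i _ => hm i)
      (fun i _ j _ hij => hU.indep.indepFun hij),
      Finset.sum_congr rfl fun i _ => (hU.identDistrib i).variance_eq.trans hU.variance]
    simp
  have hmean : ∫ ω, (∑ i ∈ Finset.range k, U i) ω ∂P = k * (1 / α) := by
    simp_rw [Finset.sum_apply]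
    rw [integral_finsetSum _ fun i _ => (hm i).integrable one_le_two,
      Finset.sum_congr rfl fun i _ => (hU.identDistrib i).integral_eq.trans hU.mean]
    simp
  rw [← hvar, hL.ofReal_variance_eq, evariance_eq_lintegral_ofReal, hmean]
  simp only [Finset.sum_apply]

theorem IsInterarrivalSequence.lintegral_exp_neg_le (hU : IsInterarrivalSequence P U α σ)
    {c : ℝ} (hc : 0 ≤ c) :
    ∫⁻ ω, ENNReal.ofReal (Real.exp (-(c * U 0 ω))) ∂P ≤
      ENNReal.ofReal (1 - c * (1 / α - c * (σ ^ 2 + (1 / α) ^ 2) / 2)) := by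
  have hi := hU.memLp.integrable one_le_two
  have hsq := hU.memLp.integrable_sq
  have hm2 : ∫ ω, U 0 ω ^ 2 ∂P = σ ^ 2 + (1 / α) ^ 2 := by
    have h := variance_eq_sub hU.memLp
    rw [hU.variance, hU.mean] at h
    simp only [Pi.pow_apply] at h
    linarith
  have hi1 : Integrable (fun ω => 1 - c * U 0 ω + c ^ 2 / 2 * U 0 ω ^ 2) P :=
    ((integrable_const 1).sub (hi.const_mul c)).add (hsq.const_mul _)
  have hint : ∫ ω, (1 - c * U 0 ω + c ^ 2 / 2 * U 0 ω ^ 2) ∂P =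
      1 - c * (1 / α - c * (σ ^ 2 + (1 / α) ^ 2) / 2) := by
    have hi2 : Integrable (fun ω => 1 - c * U 0 ω) P := (integrable_const 1).sub (hi.const_mul c)
    rw [integral_add hi2 (hsq.const_mul _), integral_sub (integrable_const 1) (hi.const_mul c),
      integral_const_mul, integral_const_mul, hm2, hU.mean]
    simp
    ring
  have hle : ∀ᵐ ω ∂P, Real.exp (-(c * U 0 ω)) ≤ 1 - c * U 0 ω + c ^ 2 / 2 * U 0 ω ^ 2 := by
    filter_upwards [hU.pos] with ω hω
    refine (exp_neg_le_quadratic (mul_nonneg hc hω.le)).trans_eq ?_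
    ring
  rw [← hint, ofReal_integral_eq_lintegral_ofReal hi1]
  · refine lintegral_mono_ae ?_
    filter_upwards [hle] with ω hω using ENNReal.ofReal_le_ofReal hω
  · filter_upwards [hle] with ω hω using (Real.exp_pos _).le.trans hω

omit [IsProbabilityMeasure P] in
theorem IsInterarrivalSequence.lintegral_exp_neg_sum (hU : IsInterarrivalSequence P U α σ)
    (c : ℝ) (k : ℕ) :
    ∫⁻ ω, ENNReal.ofReal (Real.exp (-(c * ∑ i ∈ Finset.range k, U i ω))) ∂P =
      (∫⁻ ω, ENNReal.ofReal (Real.exp (-(c * U 0 ω))) ∂P) ^ k := by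
  let φ : ℝ → ℝ≥0∞ := fun x => ENNReal.ofReal (Real.exp (-(c * x)))
  have hφ : Measurable φ := by fun_prop
  have h1 := lintegral_prod_eq_prod_lintegral_of_indepFun (μ := P) (Finset.range k)
    (fun i ω => φ (U i ω)) (hU.indep.comp (fun _ => φ) fun _ => hφ)
    (fun i => hφ.comp (hU.measurable i))
  have h2 : ∀ i, ∫⁻ ω, φ (U i ω) ∂P = ∫⁻ ω, φ (U 0 ω) ∂P := fun i =>
    ((hU.identDistrib i).comp hφ).lintegral_eq
  rw [Finset.prod_congr rfl fun i _ => h2 i, Finset.prod_const, Finset.card_range] at h1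
  refine Eq.trans (lintegral_congr fun ω => ?_) h1
  simp only [φ]
  rw [← ENNReal.ofReal_prod_of_nonneg fun _ _ => (Real.exp_pos _).le, ← Real.exp_sum,
    Finset.sum_neg_distrib, Finset.mul_sum]

/-- Upper deviation of a renewal process. The rate `1 / ν` is slightly larger than the true rate
`α`; the gap makes the geometric series of exponential moments bounded uniformly in `t`. -/
theorem IsInterarrivalSequence.lintegral_renewalCount_sub_le
    (hU : IsInterarrivalSequence P U α σ) {t c ν : ℝ} (ht : 0 ≤ t) (hc : 0 < c)
    (hν : ν = 1 / α - c * (σ ^ 2 + (1 / α) ^ 2) / 2) (hν0 : 0 < ν) :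
    ∫⁻ ω, ENNReal.ofReal (renewalCount U t ω - t / ν) ∂P ≤ ENNReal.ofReal (1 / (c * ν)) := by
  set ρ := ∫⁻ ω, ENNReal.ofReal (Real.exp (-(c * U 0 ω))) ∂P with hρ
  have hρle : ρ ≤ ENNReal.ofReal (1 - c * ν) := hν ▸ hU.lintegral_exp_neg_le hc.le
  have hρ0 : 0 < ρ := by
    have hmeas := hU.measurable 0
    refine pos_iff_ne_zero.2 fun h0 => ?_
    rw [hρ, lintegral_eq_zero_iff (by fun_prop)] at h0
    obtain ⟨ω, hω⟩ := h0.exists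
    simp only [Pi.zero_apply, ENNReal.ofReal_eq_zero] at hω
    exact absurd (Real.exp_pos _) (not_lt.2 hω)
  have hq : 0 < 1 - c * ν := ENNReal.ofReal_pos.1 (hρ0.trans_le hρle)
  have hcν : 0 < c * ν := mul_pos hc hν0
  set k₀ := ⌊t / ν⌋₊
  have hk₀ : (k₀ : ℝ) ≤ t / ν := Nat.floor_le (by positivity)
  have hk₁ : t ≤ ν * (k₀ + 1) := by
    have := (Nat.lt_floor_add_one (t / ν)).le
    rw [div_le_iff₀ hν0] at this
    linarith
  have hterm : ∀ k : ℕ, ∫⁻ ω, ENNReal.ofReal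
      (Real.exp (c * (t - ∑ i ∈ Finset.range (k₀ + 1 + k), U i ω))) ∂P ≤
      ENNReal.ofReal (1 - c * ν) ^ k := by
    intro k
    have h1 : ∀ ω, ENNReal.ofReal
        (Real.exp (c * (t - ∑ i ∈ Finset.range (k₀ + 1 + k), U i ω))) =
        ENNReal.ofReal (Real.exp (c * t)) *
        ENNReal.ofReal (Real.exp (-(c * ∑ i ∈ Finset.range (k₀ + 1 + k), U i ω))) := by
      intro ω
      rw [← ENNReal.ofReal_mul (Real.exp_pos _).le, ← Real.exp_add]
      congr 2
      ring
    simp_rw [h1]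
    rw [lintegral_const_mul' _ _ ENNReal.ofReal_ne_top, hU.lintegral_exp_neg_sum]
    have h2 : ENNReal.ofReal (Real.exp (c * t)) * ENNReal.ofReal (1 - c * ν) ^ (k₀ + 1) ≤ 1 := by
      rw [← ENNReal.ofReal_pow hq.le, ← ENNReal.ofReal_mul (Real.exp_pos _).le,
        ENNReal.ofReal_le_one]
      have h3 : 1 - c * ν ≤ Real.exp (-(c * ν)) := by
        have := Real.add_one_le_exp (-(c * ν)); linarith
      calc Real.exp (c * t) * (1 - c * ν) ^ (k₀ + 1)
          ≤ Real.exp (c * t) * Real.exp (-(c * ν)) ^ (k₀ + 1) := by gcongr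
        _ = Real.exp (c * (t - ν * (k₀ + 1))) := by
            rw [← Real.exp_nat_mul, ← Real.exp_add]
            congr 1
            push_cast
            ring
        _ ≤ 1 := Real.exp_le_one_iff.2 (mul_nonpos_of_nonneg_of_nonpos hc.le (by linarith))
    calc _ ≤ ENNReal.ofReal (Real.exp (c * t)) * ENNReal.ofReal (1 - c * ν) ^ (k₀ + 1 + k) := by
          gcongr
      _ = ENNReal.ofReal (Real.exp (c * t)) * ENNReal.ofReal (1 - c * ν) ^ (k₀ + 1) *
          ENNReal.ofReal (1 - c * ν) ^ k := by rw [pow_add, mul_assoc]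
      _ ≤ 1 * ENNReal.ofReal (1 - c * ν) ^ k := by gcongr
      _ = _ := one_mul _
  calc _ ≤ ∫⁻ ω, ∑' k : ℕ, ENNReal.ofReal
        (Real.exp (c * (t - ∑ i ∈ Finset.range (k₀ + 1 + k), U i ω))) ∂P := by
        refine lintegral_mono_ae ?_
        filter_upwards [hU.ae_pos, hU.ae_tendsto_sum] with ω h1 h2
        exact (ENNReal.ofReal_le_ofReal (by linarith)).trans
          (ofReal_renewalCount_sub_le h1 h2 ht hc.le k₀)
    _ = ∑' k : ℕ, ∫⁻ ω, ENNReal.ofReal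
        (Real.exp (c * (t - ∑ i ∈ Finset.range (k₀ + 1 + k), U i ω))) ∂P := by
        have hmeas := hU.measurable
        exact lintegral_tsum fun k => by fun_prop
    _ ≤ ∑' k : ℕ, ENNReal.ofReal (1 - c * ν) ^ k := ENNReal.tsum_le_tsum hterm
    _ = ENNReal.ofReal (1 / (c * ν)) := by
        rw [ENNReal.tsum_geometric, ← ENNReal.ofReal_one, ← ENNReal.ofReal_sub _ hq.le,
          ← ENNReal.ofReal_inv_of_pos (by linarith)]
        congr 1
        rw [one_div]
        congr 1
        ring

/-- Lower deviation of a renewal process, with slack `c * t` in Chebyshev's inequality. -/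
theorem IsInterarrivalSequence.lintegral_sub_renewalCount_le
    (hU : IsInterarrivalSequence P U α σ) {t c : ℝ} (ht : 0 ≤ t) (hc : 0 < c) :
    ∫⁻ ω, ENNReal.ofReal (α * t - renewalCount U t ω) ∂P ≤
      ENNReal.ofReal (α * c * t + 1 + (α * σ / c) ^ 2) := by
  have hα := hU.rate_pos
  set k₀ := ⌊α * (t - c * t)⌋₊ with hk₀
  have hle : (k₀ : ℝ) ≤ α * t := by
    rcases le_total 0 (α * (t - c * t)) with h | h
    · refine (Nat.floor_le h).trans ?_
      gcongr
      nlinarith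
    · rw [hk₀, Nat.floor_of_nonpos h, Nat.cast_zero]; positivity
  have hlt := Nat.lt_floor_add_one (α * (t - c * t))
  rw [← hk₀] at hlt
  have hsum : ∫⁻ ω, ENNReal.ofReal (k₀ - renewalCount U t ω) ∂P ≤
      ENNReal.ofReal ((α * σ / c) ^ 2) := by
    rcases Nat.eq_zero_or_pos k₀ with h0 | h0
    · have : ∀ ω, ENNReal.ofReal (k₀ - renewalCount U t ω) = 0 := fun ω => by
        rw [h0, ENNReal.ofReal_eq_zero]; simp
      simp [this]
    have hle' : (k₀ : ℝ) ≤ α * (t - c * t) := by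
      refine Nat.floor_le (le_of_not_gt fun h => ?_)
      rw [hk₀, Nat.floor_of_nonpos h.le] at h0
      exact lt_irrefl _ h0
    have ht0 : 0 < t := ht.lt_of_ne fun h => by
      have h1 : (0 : ℝ) < k₀ := by exact_mod_cast h0
      rw [← h] at hle
      linarith
    have hδ : 0 < c * t := mul_pos hc ht0
    have hkk : ∀ k : ℕ, k ≤ k₀ → (k : ℝ) * (1 / α) ≤ t - c * t := fun k hk => by
      rw [mul_one_div, div_le_iff₀ hα]
      have : (k : ℝ) ≤ k₀ := by exact_mod_cast hk
      linarith
    have hmeas := hU.measurable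
    calc _ ≤ ∫⁻ ω, ∑ k ∈ Finset.range k₀, ENNReal.ofReal
          ((∑ i ∈ Finset.range (k + 1), U i ω - (k + 1 : ℕ) * (1 / α)) ^ 2 / (c * t) ^ 2) ∂P := by
          refine lintegral_mono_ae ?_
          filter_upwards [hU.ae_pos, hU.ae_tendsto_sum] with ω h1 h2
          exact ofReal_sub_renewalCount_le h1 h2 ht hδ k₀ hkk
      _ = ∑ k ∈ Finset.range k₀, ENNReal.ofReal ((k + 1 : ℕ) * σ ^ 2 / (c * t) ^ 2) := by
          rw [lintegral_finsetSum _ fun k _ => by fun_prop]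
          refine Finset.sum_congr rfl fun k _ => ?_
          simp_rw [div_eq_mul_inv _ ((c * t) ^ 2)]
          rw [ENNReal.ofReal_mul (by positivity), ← hU.lintegral_sq_sum_sub,
            ← lintegral_mul_const' _ _ ENNReal.ofReal_ne_top]
          exact lintegral_congr fun ω => ENNReal.ofReal_mul (sq_nonneg _)
      _ ≤ ∑ k ∈ Finset.range k₀, ENNReal.ofReal (k₀ * σ ^ 2 / (c * t) ^ 2) := by
          refine Finset.sum_le_sum fun k hk => ENNReal.ofReal_le_ofReal ?_
          have : k + 1 ≤ k₀ := Finset.mem_range.1 hk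
          gcongr
      _ = ENNReal.ofReal (k₀ * (k₀ * σ ^ 2 / (c * t) ^ 2)) := by
          rw [Finset.sum_const, Finset.card_range, nsmul_eq_mul, ← ENNReal.ofReal_natCast,
            ← ENNReal.ofReal_mul (by positivity)]
      _ ≤ _ := by
          refine ENNReal.ofReal_le_ofReal ?_
          calc (k₀ : ℝ) * (k₀ * σ ^ 2 / (c * t) ^ 2)
              ≤ (α * t) * ((α * t) * σ ^ 2 / (c * t) ^ 2) := by gcongr
            _ = _ := by field_simp
  calc _ ≤ ∫⁻ ω, (ENNReal.ofReal (α * c * t + 1) +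
        ENNReal.ofReal (k₀ - renewalCount U t ω)) ∂P := by
        refine lintegral_mono fun ω => ?_
        refine le_trans (ENNReal.ofReal_le_ofReal ?_) ENNReal.ofReal_add_le
        linarith
    _ = ENNReal.ofReal (α * c * t + 1) + ∫⁻ ω, ENNReal.ofReal (k₀ - renewalCount U t ω) ∂P := by
        rw [lintegral_add_left measurable_const, lintegral_const, measure_univ, mul_one]
    _ ≤ _ := by
        rw [ENNReal.ofReal_add (p := α * c * t + 1) (by positivity) (by positivity)]
        exact add_le_add_right hsum _

/-- The mean deviation of a renewal process from `α * t` is at most a small multiple of `t` plus a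
constant, with explicit dependence on the rate and the standard deviation. -/
theorem IsInterarrivalSequence.lintegral_abs_renewalCount_sub_le
    (hU : IsInterarrivalSequence P U α σ) {t c : ℝ} (ht : 0 ≤ t) (hc : 0 < c)
    (hcα : c * (α ^ 2 * σ ^ 2 + 1) ≤ α) :
    ∫⁻ ω, ENNReal.ofReal |renewalCount U t ω - α * t| ∂P ≤
      ENNReal.ofReal (c * (α ^ 2 * σ ^ 2 + 1 + α) * t + (2 * α / c + 1 + (α * σ / c) ^ 2)) := by
  have hα := hU.rate_pos
  set ν := 1 / α - c * (σ ^ 2 + (1 / α) ^ 2) / 2 with hν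
  have hν2 : ν = (1 / α) * (1 - c * (α ^ 2 * σ ^ 2 + 1) / (2 * α)) := by
    rw [hν]; field_simp
  have hhalf : c * (α ^ 2 * σ ^ 2 + 1) / (2 * α) ≤ 1 / 2 := by
    rw [div_le_div_iff₀ (by positivity) (by norm_num)]; linarith
  have hνge : 1 / (2 * α) ≤ ν := by
    rw [hν2]
    calc 1 / (2 * α) = 1 / α * (1 / 2) := by field_simp
      _ ≤ _ := by gcongr; linarith
  have hν0 : 0 < ν := lt_of_lt_of_le (by positivity) hνge
  have hN := (measurable_renewalCount hU.measurable t)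
  have h1 := hU.lintegral_renewalCount_sub_le ht hc hν hν0
  have h2 := hU.lintegral_sub_renewalCount_le ht hc
  have hinv : 1 / ν ≤ 2 * α := by
    rw [div_le_iff₀ hν0]
    calc (1 : ℝ) = 2 * α * (1 / (2 * α)) := by field_simp
      _ ≤ _ := by gcongr
  have hdiff : t / ν - α * t ≤ c * (α ^ 2 * σ ^ 2 + 1) * t := by
    have e : t / ν - α * t = (1 / ν) * (1 - α * ν) * t := by field_simp
    have e2 : 1 - α * ν = c * (α ^ 2 * σ ^ 2 + 1) / (2 * α) := by rw [hν2]; field_simp; ring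
    rw [e, e2]
    calc _ ≤ (2 * α) * (c * (α ^ 2 * σ ^ 2 + 1) / (2 * α)) * t := by gcongr
      _ = _ := by field_simp
  calc _ ≤ ∫⁻ ω, (ENNReal.ofReal (renewalCount U t ω - t / ν) +
          (ENNReal.ofReal (α * t - renewalCount U t ω) +
            ENNReal.ofReal (c * (α ^ 2 * σ ^ 2 + 1) * t))) ∂P := by
        refine lintegral_mono fun ω => ?_
        rcases le_total 0 ((renewalCount U t ω : ℝ) - α * t) with h | h
        · rw [abs_of_nonneg h]
          refine (ENNReal.ofReal_le_ofReal (q := (renewalCount U t ω - t / ν) +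
            c * (α ^ 2 * σ ^ 2 + 1) * t) (by linarith)).trans (ENNReal.ofReal_add_le.trans ?_)
          gcongr
          exact le_add_self
        · rw [abs_of_nonpos h, neg_sub]
          exact le_self_add.trans le_add_self
    _ = ∫⁻ ω, ENNReal.ofReal (renewalCount U t ω - t / ν) ∂P +
          (∫⁻ ω, ENNReal.ofReal (α * t - renewalCount U t ω) ∂P +
            ENNReal.ofReal (c * (α ^ 2 * σ ^ 2 + 1) * t)) := by
        rw [lintegral_add_left (by fun_prop), lintegral_add_left (by fun_prop), lintegral_const,
          measure_univ, mul_one]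
    _ ≤ ENNReal.ofReal (2 * α / c) + (ENNReal.ofReal (α * c * t + 1 + (α * σ / c) ^ 2) +
            ENNReal.ofReal (c * (α ^ 2 * σ ^ 2 + 1) * t)) := by
        gcongr
        refine h1.trans (ENNReal.ofReal_le_ofReal ?_)
        calc 1 / (c * ν) = (1 / ν) / c := by field_simp
          _ ≤ _ := by gcongr
    _ = _ := by
        rw [← ENNReal.ofReal_add (by positivity) (by positivity),
          ← ENNReal.ofReal_add (by positivity) (by positivity)]
        congr 1
        ring

end Renewal

/-! ### Pathwise bounds for a single queue -/

/-- An upper bound for `|renewalCount U (n s) / n - α s|`, uniform over `s ∈ [0, T]`, built from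
an equidistant grid with `m` cells. -/
noncomputable def renewalGridError {Ω : Type*} (U : ℕ → Ω → ℝ) (n : ℕ+) (m : ℕ) (α T : ℝ)
    (ω : Ω) : ℝ :=
  α * (T / m) + ∑ j ∈ Finset.range (m + 1),
    |(renewalCount U (n * (j * (T / m))) ω : ℝ) / n - α * (j * (T / m))|

theorem measurable_renewalGridError {Ω : Type*} [MeasurableSpace Ω] {U : ℕ → Ω → ℝ}
    (hU : ∀ k, Measurable (U k)) (n : ℕ+) (m : ℕ) (α T : ℝ) :
    Measurable (renewalGridError U n m α T) := by
  have hmeas := fun t => measurable_renewalCount hU t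
  unfold renewalGridError
  fun_prop

theorem abs_renewalCount_sub_le_renewalGridError {Ω : Type*} {U : ℕ → Ω → ℝ} {n : ℕ+} {m : ℕ}
    {α T s : ℝ} {ω : Ω} (hα : 0 ≤ α) (hm : 0 < m)
    (hmono : MonotoneOn (fun t => renewalCount U t ω) (Set.Ici 0)) (hs : s ∈ Set.Icc 0 T) :
    |(renewalCount U (n * s) ω : ℝ) / n - α * s| ≤ renewalGridError U n m α T ω := by
  have hn : (0 : ℝ) < n := by exact_mod_cast n.pos
  refine abs_sub_mul_le_grid (f := fun s => (renewalCount U (n * s) ω : ℝ) / n) hα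
    (fun a ha b hb hab => ?_) hm hs
  have h1 : renewalCount U (n * a) ω ≤ renewalCount U (n * b) ω :=
    hmono (mul_nonneg hn.le ha.1) (mul_nonneg hn.le hb.1) (by gcongr)
  dsimp only
  gcongr

theorem monotoneOn_integral_max_zero {f : ℝ → ℝ}
    (hf : ∀ t, 0 ≤ t → IntervalIntegrable f volume 0 t) :
    MonotoneOn (fun t => ∫ s in (0 : ℝ)..t, max (f s) 0) (Set.Ici 0) := fun _ hs t ht hst =>
  intervalIntegral.integral_mono_interval le_rfl hs hst
    (Eventually.of_forall fun _ => le_max_right _ _) (hf t ht).max_zero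

namespace DoubleEndedQueue

variable {Ω : Type*} [MeasurableSpace Ω] {P : Measure Ω}

/-- One plus the initial number in the queue plus the number of arrivals up to time `t`; almost
surely this dominates the queue length on `[0, t]`. -/
noncomputable def pathBound (Q : DoubleEndedQueue Ω P) (t : ℝ) (ω : Ω) : ℕ :=
  (Q.X 0 ω).natAbs + renewalCount Q.U t ω + renewalCount Q.V t ω + 1

theorem measurable_pathBound (Q : DoubleEndedQueue Ω P) (t : ℝ) :
    Measurable (Q.pathBound t) := by
  have h1 := measurable_renewalCount Q.interarrival_sellers.measurable t
  have h2 := measurable_renewalCount Q.interarrival_buyers.measurable t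
  have h3 : Measurable fun ω => (Q.X 0 ω).natAbs :=
    (measurable_of_countable Int.natAbs).comp (Q.measurable_X 0 le_rfl)
  exact ((h3.add h1).add h2).add_const 1

/-- `pathBound` is a function of the initial value and the interarrival times only. -/
theorem indepFun_pathBound (Q : DoubleEndedQueue Ω P) (t : ℝ) (r : ℝ≥0) :
    IndepFun (Q.pathBound t) (Q.Nsr r) P ∧ IndepFun (Q.pathBound t) (Q.Nbr r) P := by
  set m : Fin 5 → MeasurableSpace Ω := ![MeasurableSpace.comap (Q.X 0) inferInstance,
    generatedBy Q.U, generatedBy Q.V, generatedBy Q.Nsr, generatedBy Q.Nbr] with hm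
  have hle : ∀ i, m i ≤ (inferInstance : MeasurableSpace Ω) := by
    intro i
    fin_cases i
    · exact (Q.measurable_X 0 le_rfl).comap_le
    · exact iSup_le fun k => (Q.interarrival_sellers.measurable k).comap_le
    · exact iSup_le fun k => (Q.interarrival_buyers.measurable k).comap_le
    · exact iSup_le fun k => (Q.poisson_sellers.measurable k).comap_le
    · exact iSup_le fun k => (Q.poisson_buyers.measurable k).comap_le
  set S : Set (Fin 5) := {0, 1, 2}
  have hS : ∀ i ∈ S, m i ≤ ⨆ i ∈ S, m i := fun i hi => le_iSup₂_of_le i hi le_rfl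
  have hpb : MeasurableSpace.comap (Q.pathBound t) inferInstance ≤ ⨆ i ∈ S, m i := by
    rw [← measurable_iff_comap_le]
    have h1 : Measurable[⨆ i ∈ S, m i] (renewalCount Q.U t) := by
      refine @measurable_renewalCount Ω (⨆ i ∈ S, m i) _ (fun k => ?_) t
      rw [measurable_iff_comap_le]
      exact (le_iSup (fun k => MeasurableSpace.comap (Q.U k) inferInstance) k).trans
        (hS 1 (by simp [S]))
    have h2 : Measurable[⨆ i ∈ S, m i] (renewalCount Q.V t) := by
      refine @measurable_renewalCount Ω (⨆ i ∈ S, m i) _ (fun k => ?_) t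
      rw [measurable_iff_comap_le]
      exact (le_iSup (fun k => MeasurableSpace.comap (Q.V k) inferInstance) k).trans
        (hS 2 (by simp [S]))
    have h3 : Measurable[⨆ i ∈ S, m i] fun ω => (Q.X 0 ω).natAbs := by
      refine (measurable_of_countable Int.natAbs).comp ?_
      rw [measurable_iff_comap_le]
      exact hS 0 (by simp [S])
    exact ((h3.add h1).add h2).add_const 1
  have key : ∀ (j : Fin 5) (N : ℝ≥0 → Ω → ℕ), j ∉ S → m j = generatedBy N →
      IndepFun (Q.pathBound t) (N r) P := by
    intro j N hj hmj
    rw [IndepFun_iff_Indep]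
    have h := indep_iSup_of_disjoint hle Q.indep (Set.disjoint_singleton_right.2 hj)
    refine indep_of_indep_of_le_left (indep_of_indep_of_le_right h ?_) hpb
    simp only [Set.mem_singleton_iff, iSup_iSup_eq_left, hmj]
    exact le_iSup (fun r => MeasurableSpace.comap (N r) inferInstance) r
  exact ⟨key 3 Q.Nsr (by simp [S]) rfl, key 4 Q.Nbr (by simp [S]) rfl⟩

theorem measurable_fluidScaled (Q : DoubleEndedQueue Ω P) (n : ℕ+) {t : ℝ} (ht : 0 ≤ t) :
    Measurable (Q.fluidScaled n t) := by
  have h : Measurable fun ω => (Q.X (n * t) ω : ℝ) :=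
    (measurable_of_countable (fun k : ℤ => (k : ℝ))).comp (Q.measurable_X _ (by positivity))
  exact h.div_const _

theorem ae_monotoneOn_renewalCount [IsProbabilityMeasure P] (Q : DoubleEndedQueue Ω P) :
    ∀ᵐ ω ∂P, MonotoneOn (fun t => renewalCount Q.U t ω) (Set.Ici 0) ∧
      MonotoneOn (fun t => renewalCount Q.V t ω) (Set.Ici 0) := by
  filter_upwards [Q.interarrival_sellers.ae_pos, Q.interarrival_sellers.ae_tendsto_sum,
    Q.interarrival_buyers.ae_pos, Q.interarrival_buyers.ae_tendsto_sum] with ω h1 h2 h3 h4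
  exact ⟨monotoneOn_renewalCount h1 h2, monotoneOn_renewalCount h3 h4⟩

theorem ae_abs_le_pathBound [IsProbabilityMeasure P] (Q : DoubleEndedQueue Ω P) :
    ∀ᵐ ω ∂P, ∀ T, ∀ t ∈ Set.Icc 0 T, |(Q.X t ω : ℝ)| ≤ Q.pathBound T ω := by
  filter_upwards [Q.ae_monotoneOn_renewalCount, Q.poisson_sellers.mono, Q.poisson_buyers.mono,
    Q.poisson_sellers.zero, Q.poisson_buyers.zero, Q.poisson_sellers.ae_unit_jumps,
    Q.poisson_buyers.ae_unit_jumps, Q.locallyIntegrable_X, Q.evolution]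
    with ω hmono hsm hbm hs0 hb0 hsj hbj hint hev T t ht
  obtain ⟨hU, hV⟩ := hmono
  have hint' : ∀ t, 0 ≤ t → IntervalIntegrable (fun s => -(Q.X s ω : ℝ)) volume 0 t :=
    fun t ht => (hint t ht).neg
  have hev' : ∀ t, 0 ≤ t → (Q.X t ω : ℝ) = Q.X 0 ω + (renewalCount Q.U t ω : ℝ)
      - (renewalCount Q.V t ω : ℝ)
      - (Q.Nsr (Real.toNNReal (Q.θ * ∫ s in (0 : ℝ)..t, max (Q.X s ω : ℝ) 0)) ω : ℝ)
      + (Q.Nbr (Real.toNNReal (Q.γ * ∫ s in (0 : ℝ)..t, max (-(Q.X s ω : ℝ)) 0)) ω : ℝ) :=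
    fun t ht => by exact_mod_cast hev t ht
  have mono_cast : ∀ {U : ℕ → Ω → ℝ}, MonotoneOn (fun t => renewalCount U t ω) (Set.Ici 0) →
      MonotoneOn (fun t => (renewalCount U t ω : ℝ)) (Set.Ici 0) := fun h a ha b hb hab => by
    dsimp only
    exact_mod_cast h ha hb hab
  have mono_abandon : ∀ {N : ℝ≥0 → Ω → ℕ} {g : ℝ} {f : ℝ → ℝ}, 0 ≤ g →
      (Monotone fun t => N t ω) → (∀ t, 0 ≤ t → IntervalIntegrable f volume 0 t) →
      MonotoneOn (fun t => (N (Real.toNNReal (g * ∫ s in (0 : ℝ)..t, max (f s) 0)) ω : ℝ))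
        (Set.Ici 0) := by
    intro N g f hg hN hf a ha b hb hab
    dsimp only
    have h1 := monotoneOn_integral_max_zero hf ha hb hab
    exact_mod_cast hN (Real.toNNReal_le_toNNReal (mul_le_mul_of_nonneg_left h1 hg))
  have hup := path_le_of_unit_jumps (f := fun s => (Q.X s ω : ℝ))
    (a := fun s => (renewalCount Q.U s ω : ℝ))
    (d := fun s => (renewalCount Q.V s ω : ℝ) +
      (Q.Nsr (Real.toNNReal (Q.θ * ∫ r in (0 : ℝ)..s, max (Q.X r ω : ℝ) 0)) ω : ℝ))
    (N := fun r => Q.Nbr r ω) ht.1 Q.γ_pos.le (hint t ht.1) (mono_cast hU)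
    ((mono_cast hV).add (mono_abandon Q.θ_pos.le hsm hint)) (by positivity) (by positivity)
    hb0 hbj (fun s hs => by rw [hev' s hs.1]; ring)
  have hlow := path_le_of_unit_jumps (f := fun s => -(Q.X s ω : ℝ))
    (a := fun s => (renewalCount Q.V s ω : ℝ))
    (d := fun s => (renewalCount Q.U s ω : ℝ) +
      (Q.Nbr (Real.toNNReal (Q.γ * ∫ r in (0 : ℝ)..s, max (-(Q.X r ω : ℝ)) 0)) ω : ℝ))
    (N := fun r => Q.Nsr r ω) ht.1 Q.θ_pos.le (hint' t ht.1) (mono_cast hV)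
    ((mono_cast hU).add (mono_abandon Q.γ_pos.le hbm hint')) (by positivity) (by positivity)
    hs0 hsj (fun s hs => by simp only [neg_neg]; rw [hev' s hs.1]; ring)
  have hT : (0 : ℝ) ≤ T := ht.1.trans ht.2
  have hUT := mono_cast hU (Set.mem_Ici.2 ht.1) (Set.mem_Ici.2 hT) ht.2
  have hVT := mono_cast hV (Set.mem_Ici.2 ht.1) (Set.mem_Ici.2 hT) ht.2
  have hcast : (Q.pathBound T ω : ℝ) = |(Q.X 0 ω : ℝ)| + renewalCount Q.U T ω
      + renewalCount Q.V T ω + 1 := by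
    simp only [pathBound]
    push_cast
    rw [Nat.cast_natAbs, Int.cast_abs]
  have hUn : (0 : ℝ) ≤ renewalCount Q.U T ω := by positivity
  have hVn : (0 : ℝ) ≤ renewalCount Q.V T ω := by positivity
  dsimp only at hup hlow hUT hVT
  rw [abs_neg] at hlow
  rw [hcast, abs_le]
  constructor <;> linarith

/-- The sum of the errors, over the time interval `[0, T]`, made by replacing the driving
processes and the reneging rates in the fluid scaled evolution equation by their limits.
The four numbers `mU`, `mV`, `ms`, `mb` are the sizes of the grids used to control the four
counting processes. -/
noncomputable def fluidError (Q : DoubleEndedQueue Ω P) (n : ℕ+) (α β θ γ T : ℝ)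
    (mU mV ms mb : ℕ) (ω : Ω) : ℝ :=
  renewalGridError Q.U n mU α T ω + renewalGridError Q.V n mV β T ω
    + gridError Q.Nsr ms (n * Q.θ * T * Q.pathBound (n * T) ω) ω / n
    + gridError Q.Nbr mb (n * Q.γ * T * Q.pathBound (n * T) ω) ω / n
    + (|n * Q.θ - θ| + |n * Q.γ - γ|) * T * (Q.pathBound (n * T) ω / n)

/-- The pathwise comparison of the scaled queue length with the fluid path. -/
theorem ae_abs_fluidScaled_sub_le [IsProbabilityMeasure P] (Q : DoubleEndedQueue Ω P) (n : ℕ+)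
    {α β θ γ x₀ T : ℝ} {x : ℝ → ℝ} (hα : 0 ≤ α) (hβ : 0 ≤ β) (hθ : 0 ≤ θ) (hγ : 0 ≤ γ)
    (hT : 0 ≤ T) (hx : IsFluidSolution α β θ γ x₀ x) {mU mV ms mb : ℕ} (hmU : 0 < mU)
    (hmV : 0 < mV) (hms : 0 < ms) (hmb : 0 < mb) :
    ∀ᵐ ω ∂P, ∀ t ∈ Set.Icc 0 T, |Q.fluidScaled n t ω - x t| ≤
      (|Q.fluidScaled n 0 ω - x₀| + Q.fluidError n α β θ γ T mU mV ms mb ω)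
        * Real.exp ((θ + γ) * T) := by
  filter_upwards [Q.ae_monotoneOn_renewalCount, Q.poisson_sellers.mono, Q.poisson_buyers.mono,
    Q.locallyIntegrable_X, Q.evolution, Q.ae_abs_le_pathBound]
    with ω hmono hsm hbm hint hev hbd
  obtain ⟨hU, hV⟩ := hmono
  have hn : (0 : ℝ) < n := by exact_mod_cast n.pos
  set κ := Q.pathBound (n * T) ω with hκ
  set y : ℝ → ℝ := fun t => Q.fluidScaled n t ω with hy
  have hyX : ∀ s, y s = (Q.X (n * s) ω : ℝ) / n := fun s => rfl
  have hyint : ∀ s, 0 ≤ s → IntervalIntegrable y volume 0 s := by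
    intro s hs
    have h1 := (hint (n * s) (mul_nonneg hn.le hs)).comp_mul_left (c := (n : ℝ))
    rw [zero_div, mul_div_cancel_left₀ _ hn.ne'] at h1
    exact h1.div_const _
  have hybd : ∀ s ∈ Set.Icc 0 T, |y s| ≤ κ / n := by
    intro s hs
    rw [hyX, abs_div, abs_of_pos hn]
    gcongr
    exact hbd (n * T) (n * s) ⟨mul_nonneg hn.le hs.1, by have := hs.2; gcongr⟩
  -- the clocks of the abandonments, in terms of the scaled path
  have hclock : ∀ (p : ℝ → ℝ) (s : ℝ), (∀ a, p (a / n) = p a / n) →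
      ∫ r in (0 : ℝ)..n * s, p (Q.X r ω) = n * (n * ∫ r in (0 : ℝ)..s, p (y r)) := by
    intro p s hp
    have h1 := intervalIntegral.mul_integral_comp_mul_left (a := 0) (b := s)
      (f := fun r => p (Q.X r ω)) (n : ℝ)
    rw [mul_zero] at h1
    rw [← h1]
    simp only [hyX, hp, intervalIntegral.integral_div]
    field_simp
  have hpos : ∀ a : ℝ, max (a / n) 0 = max a 0 / n := fun a => by
    rw [← max_div_div_right hn.le, zero_div]
  have hneg : ∀ a : ℝ, max (-(a / n)) 0 = max (-a) 0 / n := fun a => by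
    rw [← neg_div, hpos]
  have hIle : ∀ (p : ℝ → ℝ), (∀ a, 0 ≤ p a ∧ p a ≤ |a|) → ∀ s ∈ Set.Icc 0 T,
      0 ≤ ∫ r in (0 : ℝ)..s, p (y r) ∧ ∫ r in (0 : ℝ)..s, p (y r) ≤ T * (κ / n) := by
    intro p hp s hs
    refine ⟨intervalIntegral.integral_nonneg hs.1 fun r _ => (hp _).1, ?_⟩
    have h1 : ‖∫ r in (0 : ℝ)..s, p (y r)‖ ≤ κ / n * |s - 0| :=
      intervalIntegral.norm_integral_le_of_norm_le_const fun r hr => by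
        rw [Set.uIoc_of_le hs.1] at hr
        rw [Real.norm_eq_abs, abs_of_nonneg (hp _).1]
        exact (hp _).2.trans (hybd r ⟨hr.1.le, hr.2.trans hs.2⟩)
    rw [sub_zero, abs_of_nonneg hs.1] at h1
    refine (le_abs_self _).trans (h1.trans ?_)
    rw [mul_comm]
    have := hs.2
    gcongr
  have hclockerr : ∀ (N : ℝ≥0 → Ω → ℕ) (m : ℕ) (g I : ℝ), 0 < m → 0 ≤ g →
      (Monotone fun t => N t ω) → 0 ≤ I → I ≤ T * (κ / n) →
      |(N (Real.toNNReal (g * (n * (n * I)))) ω : ℝ) / n - n * g * I| ≤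
        gridError N m (n * g * T * κ) ω / n := by
    intro N m g I hm hg hN hI0 hI
    have h1 := abs_sub_le_gridError (N := N) (ω := ω) (h := n * g * T * κ) hm hN
      (r := g * (n * (n * I))) ⟨by positivity, by
        calc g * (n * (n * I)) ≤ g * (n * (n * (T * (κ / n)))) := by gcongr
          _ = _ := by field_simp⟩
    have h2 : (N (Real.toNNReal (g * (n * (n * I)))) ω : ℝ) / n - n * g * I
        = ((N (Real.toNNReal (g * (n * (n * I)))) ω : ℝ) - g * (n * (n * I))) / n := by
      field_simp
    rw [h2, abs_div, abs_of_pos hn]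
    gcongr
  set E : ℝ → ℝ := fun t => y t - (y 0 + (α - β) * t - θ * (∫ s in (0 : ℝ)..t, max (y s) 0)
      + γ * ∫ s in (0 : ℝ)..t, max (-y s) 0) with hE
  refine hx.abs_sub_le (y := y) (E := E) hθ hγ (hyint T hT) (fun t _ => by simp only [hE]; ring)
    fun t ht => ?_
  set Ip := ∫ s in (0 : ℝ)..t, max (y s) 0 with hIp
  set In := ∫ s in (0 : ℝ)..t, max (-y s) 0 with hIn
  obtain ⟨hIp0, hIp1⟩ := hIle (fun a => max a 0)
    (fun a => ⟨le_max_right _ _, max_le (le_abs_self _) (abs_nonneg _)⟩) t ht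
  obtain ⟨hIn0, hIn1⟩ := hIle (fun a => max (-a) 0)
    (fun a => ⟨le_max_right _ _, max_le (neg_le_abs _) (abs_nonneg _)⟩) t ht
  have hev' : (Q.X (n * t) ω : ℝ) = Q.X 0 ω + (renewalCount Q.U (n * t) ω : ℝ)
      - (renewalCount Q.V (n * t) ω : ℝ) - (Q.Nsr (Real.toNNReal (Q.θ * (n * (n * Ip)))) ω : ℝ)
      + (Q.Nbr (Real.toNNReal (Q.γ * (n * (n * In)))) ω : ℝ) := by
    rw [hIp, hIn, ← hclock (fun a => max a 0) t hpos, ← hclock (fun a => max (-a) 0) t hneg]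
    exact_mod_cast hev (n * t) (mul_nonneg hn.le ht.1)
  have e1 := abs_renewalCount_sub_le_renewalGridError (n := n) hα hmU hU ht
  have e2 := abs_renewalCount_sub_le_renewalGridError (n := n) hβ hmV hV ht
  have e3 := hclockerr Q.Nsr ms Q.θ Ip hms Q.θ_pos.le hsm hIp0 hIp1
  have e4 := hclockerr Q.Nbr mb Q.γ In hmb Q.γ_pos.le hbm hIn0 hIn1
  have e5 : |(n * Q.θ - θ) * Ip| ≤ |n * Q.θ - θ| * (T * (κ / n)) := by
    rw [abs_mul, abs_of_nonneg hIp0]; gcongr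
  have e6 : |(n * Q.γ - γ) * In| ≤ |n * Q.γ - γ| * (T * (κ / n)) := by
    rw [abs_mul, abs_of_nonneg hIn0]; gcongr
  have hEt : E t = (((renewalCount Q.U (n * t) ω : ℝ) / n - α * t)
      - ((renewalCount Q.V (n * t) ω : ℝ) / n - β * t))
      - ((Q.Nsr (Real.toNNReal (Q.θ * (n * (n * Ip)))) ω : ℝ) / n - n * Q.θ * Ip)
      + ((Q.Nbr (Real.toNNReal (Q.γ * (n * (n * In)))) ω : ℝ) / n - n * Q.γ * In)
      - (n * Q.θ - θ) * Ip + (n * Q.γ - γ) * In := by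
    simp only [hE]
    rw [hyX t, hyX 0, mul_zero, hev']
    ring
  rw [hEt, fluidError, ← hκ]
  rw [abs_le] at e1 e2 e3 e4 e5 e6 ⊢
  constructor <;> linarith [e1.1, e1.2, e2.1, e2.2, e3.1, e3.2, e4.1, e4.2, e5.1, e5.2, e6.1, e6.2]

end DoubleEndedQueue

/-! ### The fluid limit -/

theorem tendsto_pnat_cast_atTop : Tendsto (fun n : ℕ+ => (n : ℝ)) atTop atTop :=
  tendsto_natCast_atTop_atTop.comp tendsto_PNat_val_atTop_atTop

theorem tendsto_const_div_pnat (C : ℝ) : Tendsto (fun n : ℕ+ => C / (n : ℝ)) atTop (𝓝 0) :=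
  tendsto_pnat_cast_atTop.const_div_atTop C

theorem tendsto_zero_of_forall_ofReal {ι : Type*} {l : Filter ι} {u : ι → ℝ≥0∞}
    (h : ∀ ε : ℝ, 0 < ε → ∀ᶠ i in l, u i ≤ ENNReal.ofReal ε) : Tendsto u l (𝓝 0) := by
  refine ENNReal.tendsto_nhds_zero.2 fun ε hε => ?_
  obtain ⟨δ, hδ0, hδ⟩ := ENNReal.lt_iff_exists_nnreal_btwn.1 hε
  have hδ' : (0 : ℝ) < δ := by exact_mod_cast hδ0
  filter_upwards [h δ hδ'] with i hi
  rw [ENNReal.ofReal_coe_nnreal] at hi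
  exact hi.trans hδ.le

theorem lintegral_ofReal_div {Ω : Type*} [MeasurableSpace Ω] {P : Measure Ω} (f : Ω → ℝ) {c : ℝ}
    (hc : 0 < c) : ∫⁻ ω, ENNReal.ofReal (f ω / c) ∂P =
      (∫⁻ ω, ENNReal.ofReal (f ω) ∂P) / ENNReal.ofReal c := by
  simp_rw [ENNReal.ofReal_div_of_pos hc, div_eq_mul_inv]
  exact lintegral_mul_const' _ _ (ENNReal.inv_ne_top.2 (by simpa using hc))

section Family

variable {Ω : ℕ+ → Type*} [∀ n, MeasurableSpace (Ω n)] {P : ∀ n, Measure (Ω n)}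
  [∀ n, IsProbabilityMeasure (P n)]

/-- The weak law of large numbers for a triangular array of renewal processes, in `L¹`. -/
theorem tendsto_lintegral_abs_renewalCount {U : ∀ n, ℕ → Ω n → ℝ} {a s : ℕ+ → ℝ} {α σ : ℝ}
    (hU : ∀ n, IsInterarrivalSequence (P n) (U n) (a n) (s n)) (hα : 0 < α)
    (ha : Tendsto a atTop (𝓝 α)) (hs : Tendsto s atTop (𝓝 σ)) {t : ℝ} (ht : 0 ≤ t) :
    Tendsto (fun n => ∫⁻ ω, ENNReal.ofReal
      |(renewalCount (U n) (n * t) ω : ℝ) / n - α * t| ∂(P n)) atTop (𝓝 0) := by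
  refine tendsto_zero_of_forall_ofReal fun ε hε => ?_
  obtain ⟨c, hc0, hc1, hc2⟩ : ∃ c : ℝ, 0 < c ∧ c * (α ^ 2 * σ ^ 2 + 1) < α ∧
      c * (α ^ 2 * σ ^ 2 + 1 + α) * t < ε := by
    have h1 : Tendsto (fun c : ℝ => c * (α ^ 2 * σ ^ 2 + 1)) (𝓝[>] 0) (𝓝 0) := by
      refine ((by fun_prop : Continuous fun c : ℝ => c * (α ^ 2 * σ ^ 2 + 1)).tendsto' 0 0
        (by simp)).mono_left nhdsWithin_le_nhds
    have h2 : Tendsto (fun c : ℝ => c * (α ^ 2 * σ ^ 2 + 1 + α) * t) (𝓝[>] 0) (𝓝 0) := by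
      refine ((by fun_prop : Continuous fun c : ℝ => c * (α ^ 2 * σ ^ 2 + 1 + α) * t).tendsto' 0 0
        (by simp)).mono_left nhdsWithin_le_nhds
    obtain ⟨c, h3, h4, h5⟩ := (eventually_mem_nhdsWithin.and
      ((h1.eventually_lt_const hα).and (h2.eventually_lt_const hε))).exists
    exact ⟨c, h3, h4, h5⟩
  have hinv : Tendsto (fun n : ℕ+ => 1 / (n : ℝ)) atTop (𝓝 0) := tendsto_const_div_pnat 1
  have hl1 : Tendsto (fun n => c * (a n ^ 2 * s n ^ 2 + 1)) atTop
      (𝓝 (c * (α ^ 2 * σ ^ 2 + 1))) :=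
    (((ha.pow 2).mul (hs.pow 2)).add_const 1).const_mul c
  have hl2 : Tendsto (fun n : ℕ+ => c * (a n ^ 2 * s n ^ 2 + 1 + a n) * t
      + (2 * a n / c + 1 + (a n * s n / c) ^ 2) * (1 / (n : ℝ)) + |a n - α| * t) atTop
      (𝓝 (c * (α ^ 2 * σ ^ 2 + 1 + α) * t
        + (2 * α / c + 1 + (α * σ / c) ^ 2) * 0 + |α - α| * t)) := by
    refine (Tendsto.add ?_ (Tendsto.mul ?_ hinv)).add ?_
    · exact ((((ha.pow 2).mul (hs.pow 2)).add_const 1).add ha |>.const_mul c).mul_const t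
    · exact (((ha.const_mul 2).div_const c).add_const 1).add (((ha.mul hs).div_const c).pow 2)
    · exact (ha.sub_const α).abs.mul_const t
  simp only [mul_zero, add_zero, sub_self, abs_zero, zero_mul] at hl2
  filter_upwards [hl1.eventually_lt ha hc1, hl2.eventually_lt_const hc2] with n h1 h2
  have hn : (0 : ℝ) < n := by exact_mod_cast n.pos
  have hα' := (hU n).rate_pos
  have hmain := (hU n).lintegral_abs_renewalCount_sub_le (t := n * t) (by positivity) hc0 h1.le
  calc _ ≤ ∫⁻ ω, (ENNReal.ofReal (|(renewalCount (U n) (n * t) ω : ℝ) - a n * (n * t)| / n)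
        + ENNReal.ofReal (|a n - α| * t)) ∂(P n) := by
        refine lintegral_mono fun ω => ?_
        rw [← ENNReal.ofReal_add (by positivity) (by positivity)]
        apply ENNReal.ofReal_le_ofReal
        have e : (renewalCount (U n) (n * t) ω : ℝ) / n - α * t =
            ((renewalCount (U n) (n * t) ω : ℝ) - a n * (n * t)) / n + (a n - α) * t := by
          field_simp
          ring
        rw [e]
        refine (abs_add_le _ _).trans_eq ?_
        rw [abs_div, abs_of_pos hn, abs_mul, abs_of_nonneg ht]
    _ = (∫⁻ ω, ENNReal.ofReal |(renewalCount (U n) (n * t) ω : ℝ) - a n * (n * t)| ∂(P n))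
          / ENNReal.ofReal n + ENNReal.ofReal (|a n - α| * t) := by
        rw [lintegral_add_right _ measurable_const, lintegral_const, measure_univ, mul_one,
          lintegral_ofReal_div _ hn]
    _ ≤ ENNReal.ofReal (c * (a n ^ 2 * s n ^ 2 + 1 + a n) * (n * t) +
          (2 * a n / c + 1 + (a n * s n / c) ^ 2)) / ENNReal.ofReal n
          + ENNReal.ofReal (|a n - α| * t) := by gcongr
    _ ≤ ENNReal.ofReal ε := by
        rw [← ENNReal.ofReal_div_of_pos hn, ← ENNReal.ofReal_add (by positivity) (by positivity)]
        refine ENNReal.ofReal_le_ofReal (le_trans (le_of_eq ?_) h2.le)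
        field_simp

theorem exists_eventually_lintegral_renewalGridError_le {U : ∀ n, ℕ → Ω n → ℝ} {a s : ℕ+ → ℝ}
    {α σ : ℝ} (hU : ∀ n, IsInterarrivalSequence (P n) (U n) (a n) (s n)) (hα : 0 < α)
    (ha : Tendsto a atTop (𝓝 α)) (hs : Tendsto s atTop (𝓝 σ)) {T : ℝ} (hT : 0 ≤ T) {ε : ℝ}
    (hε : 0 < ε) :
    ∃ m : ℕ, 0 < m ∧ ∀ᶠ n : ℕ+ in atTop,
      ∫⁻ ω, ENNReal.ofReal (renewalGridError (U n) n m α T ω) ∂(P n) ≤ ENNReal.ofReal ε := by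
  obtain ⟨m, hm0, hm⟩ : ∃ m : ℕ, 0 < m ∧ α * (T / m) < ε / 2 := by
    have h := (tendsto_const_div_atTop_nhds_zero_nat (α * T)).eventually_lt_const (half_pos hε)
    obtain ⟨m, h1, h2⟩ := ((eventually_gt_atTop 0).and h).exists
    exact ⟨m, h1, by rwa [← mul_div_assoc]⟩
  have hsum : Tendsto (fun n : ℕ+ => ∑ j ∈ Finset.range (m + 1), ∫⁻ ω, ENNReal.ofReal
      |(renewalCount (U n) (n * (j * (T / m))) ω : ℝ) / n - α * (j * (T / m))| ∂(P n)) atTop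
      (𝓝 (∑ j ∈ Finset.range (m + 1), 0)) := tendsto_finsetSum _ fun j _ =>
    tendsto_lintegral_abs_renewalCount hU hα ha hs (by positivity)
  rw [Finset.sum_const_zero] at hsum
  refine ⟨m, hm0, ?_⟩
  filter_upwards [hsum.eventually_le_const (ENNReal.ofReal_pos.2 (half_pos hε))] with n hn
  have hmeas := fun t => measurable_renewalCount (hU n).measurable t
  calc _ = ∫⁻ ω, (ENNReal.ofReal (α * (T / m)) + ∑ j ∈ Finset.range (m + 1), ENNReal.ofReal
        |(renewalCount (U n) (n * (j * (T / m))) ω : ℝ) / n - α * (j * (T / m))|) ∂(P n) := by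
        refine lintegral_congr fun ω => ?_
        rw [renewalGridError, ENNReal.ofReal_add (by positivity)
          (Finset.sum_nonneg fun _ _ => abs_nonneg _),
          ENNReal.ofReal_sum_of_nonneg fun _ _ => abs_nonneg _]
    _ = ENNReal.ofReal (α * (T / m)) + ∑ j ∈ Finset.range (m + 1), ∫⁻ ω, ENNReal.ofReal
        |(renewalCount (U n) (n * (j * (T / m))) ω : ℝ) / n - α * (j * (T / m))| ∂(P n) := by
        rw [lintegral_add_left measurable_const, lintegral_const, measure_univ, mul_one,
          lintegral_finsetSum _ fun j _ => by fun_prop]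
    _ ≤ ENNReal.ofReal (ε / 2) + ENNReal.ofReal (ε / 2) :=
        add_le_add (ENNReal.ofReal_le_ofReal hm.le) hn
    _ = _ := by rw [← ENNReal.ofReal_add (by positivity) (by positivity), add_halves]

/-- The time-changed Poisson fluctuations vanish in the fluid scaling when the mean of the random
horizon grows at most linearly in `n`: the grid size `m` and then the parameter `a` in
`E |N r - r| ≤ r / a + a` are fixed before `n` tends to infinity. -/
theorem exists_eventually_lintegral_gridError_le {N : ∀ n, ℝ≥0 → Ω n → ℕ} {κ : ∀ n, Ω n → ℕ}
    {c : ℕ+ → ℝ} {C K : ℝ} (hK : 0 ≤ K) (hN : ∀ n, IsUnitPoissonProcess (P n) (N n))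
    (hκ : ∀ n, Measurable (κ n)) (hind : ∀ n r, IndepFun (κ n) (N n r) (P n))
    (hc : ∀ n, 0 ≤ c n) (hcC : ∀ᶠ n in atTop, c n ≤ C)
    (hκK : ∀ᶠ n : ℕ+ in atTop, ∫⁻ ω, κ n ω ∂(P n) ≤ ENNReal.ofReal (n * K)) {ε : ℝ}
    (hε : 0 < ε) :
    ∃ m : ℕ, 0 < m ∧ ∀ᶠ n : ℕ+ in atTop,
      ∫⁻ ω, ENNReal.ofReal (gridError (N n) m (c n * κ n ω) ω / n) ∂(P n) ≤ ENNReal.ofReal ε := by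
  obtain ⟨m, hm0, hm⟩ : ∃ m : ℕ, 0 < m ∧ C * K / m < ε := by
    have h := (tendsto_const_div_atTop_nhds_zero_nat (C * K)).eventually_lt_const hε
    exact ((eventually_gt_atTop 0).and h).exists
  have hm' : (0 : ℝ) < m := by exact_mod_cast hm0
  obtain ⟨a, ha0, ha⟩ : ∃ a : ℝ, 0 < a ∧ C * K / m + (m + 1) * C * K / a < ε := by
    have h := (tendsto_id.const_div_atTop ((m + 1) * C * K)).const_add (C * K / m)
    rw [add_zero] at h
    exact ((eventually_gt_atTop 0).and (h.eventually_lt_const hm)).exists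
  have hlim : Tendsto (fun n : ℕ+ => C * K / m + (m + 1) * C * K / a + (m + 1) * a / n) atTop
      (𝓝 (C * K / m + (m + 1) * C * K / a)) := by
    simpa using (tendsto_const_div_pnat ((m + 1) * a)).const_add _
  refine ⟨m, hm0, ?_⟩
  filter_upwards [hcC, hκK, hlim.eventually_lt_const ha] with n h1 h2 h3
  have hn : (0 : ℝ) < n := by exact_mod_cast n.pos
  have hC : 0 ≤ C := (hc n).trans h1
  have hcn := hc n
  rw [lintegral_ofReal_div _ hn]
  refine ENNReal.div_le_of_le_mul ?_
  rw [← ENNReal.ofReal_mul hε.le]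
  refine ((hN n).lintegral_gridError_le (hκ n) (hind n) hcn ha0 hm0).trans ?_
  refine (add_le_add_left (mul_le_mul' (ENNReal.ofReal_le_ofReal (q := C / m + (m + 1) * (C / a))
    (by gcongr)) h2) _).trans ?_
  rw [← ENNReal.ofReal_mul (by positivity)]
  rw [← ENNReal.ofReal_add (by positivity) (by positivity)]
  refine ENNReal.ofReal_le_ofReal ?_
  calc _ = (C * K / m + (m + 1) * C * K / a + (m + 1) * a / n) * n := by field_simp
    _ ≤ _ := by gcongr

theorem DoubleEndedQueue.exists_eventually_lintegral_pathBound_le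
    {Q : ∀ n, DoubleEndedQueue (Ω n) (P n)} {α β σ ς x₀ : ℝ} (hα : 0 < α) (hβ : 0 < β)
    (hαn : Tendsto (fun n => (Q n).α) atTop (𝓝 α)) (hβn : Tendsto (fun n => (Q n).β) atTop (𝓝 β))
    (hσn : Tendsto (fun n => (Q n).σ) atTop (𝓝 σ)) (hςn : Tendsto (fun n => (Q n).ς) atTop (𝓝 ς))
    (h₀ : Tendsto (fun n : ℕ+ =>
      ∫⁻ ω, ENNReal.ofReal |(Q n).fluidScaled n 0 ω - x₀| ∂(P n)) atTop (𝓝 0))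
    {T : ℝ} (hT : 0 ≤ T) :
    ∃ K : ℝ, 0 ≤ K ∧ ∀ᶠ n : ℕ+ in atTop,
      ∫⁻ ω, (Q n).pathBound (n * T) ω ∂(P n) ≤ ENNReal.ofReal (n * K) := by
  have hU := tendsto_lintegral_abs_renewalCount (fun n => (Q n).interarrival_sellers) hα hαn hσn hT
  have hV := tendsto_lintegral_abs_renewalCount (fun n => (Q n).interarrival_buyers) hβ hβn hςn hT
  refine ⟨3 + (|x₀| + α * T + β * T + 1), by positivity, ?_⟩
  filter_upwards [hU.eventually_le_const one_pos, hV.eventually_le_const one_pos,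
    h₀.eventually_le_const one_pos] with n h1 h2 h3
  have hn : (0 : ℝ) < n := by exact_mod_cast n.pos
  have hn1 : (1 : ℝ) ≤ n := Nat.one_le_cast.2 n.pos
  have hUm := measurable_renewalCount (Q n).interarrival_sellers.measurable (n * T)
  have hVm := measurable_renewalCount (Q n).interarrival_buyers.measurable (n * T)
  have hXm := (Q n).measurable_fluidScaled n le_rfl
  rw [ENNReal.ofReal_mul hn.le]
  calc _ ≤ ∫⁻ ω, ENNReal.ofReal n * (ENNReal.ofReal |(Q n).fluidScaled n 0 ω - x₀|
        + (ENNReal.ofReal |(renewalCount (Q n).U (n * T) ω : ℝ) / n - α * T|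
        + (ENNReal.ofReal |(renewalCount (Q n).V (n * T) ω : ℝ) / n - β * T|
        + ENNReal.ofReal (|x₀| + α * T + β * T + 1)))) ∂(P n) := by
        refine lintegral_mono fun ω => ?_
        rw [← ENNReal.ofReal_add (by positivity) (by positivity),
          ← ENNReal.ofReal_add (by positivity) (by positivity),
          ← ENNReal.ofReal_add (by positivity) (by positivity), ← ENNReal.ofReal_mul hn.le,
          ← ENNReal.ofReal_natCast]
        apply ENNReal.ofReal_le_ofReal
        simp only [DoubleEndedQueue.pathBound, DoubleEndedQueue.fluidScaled, mul_zero]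
        push_cast
        rw [Nat.cast_natAbs, Int.cast_abs]
        set X : ℝ := ((Q n).X 0 ω : ℝ)
        set A : ℝ := (renewalCount (Q n).U (n * T) ω : ℝ)
        set B : ℝ := (renewalCount (Q n).V (n * T) ω : ℝ)
        have e1 : |X| ≤ n * (|X / n - x₀| + |x₀|) := by
          have : |X| = n * |X / n| := by rw [abs_div, abs_of_pos hn]; field_simp
          rw [this]
          gcongr
          simpa using abs_add_le (X / n - x₀) x₀
        have e2 : ∀ A c : ℝ, A ≤ n * (|A / n - c| + c) := fun A c => by
          have : A = n * (A / n) := by field_simp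
          calc A = n * (A / n) := this
            _ ≤ _ := by gcongr; linarith [le_abs_self (A / n - c)]
        have e3 := e2 A (α * T)
        have e4 := e2 B (β * T)
        linarith
    _ = ENNReal.ofReal n * (∫⁻ ω, ENNReal.ofReal |(Q n).fluidScaled n 0 ω - x₀| ∂(P n)
        + (∫⁻ ω, ENNReal.ofReal |(renewalCount (Q n).U (n * T) ω : ℝ) / n - α * T| ∂(P n)
        + (∫⁻ ω, ENNReal.ofReal |(renewalCount (Q n).V (n * T) ω : ℝ) / n - β * T| ∂(P n)
        + ENNReal.ofReal (|x₀| + α * T + β * T + 1)))) := by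
        rw [lintegral_const_mul _ (by fun_prop), lintegral_add_left (by fun_prop),
          lintegral_add_left (by fun_prop), lintegral_add_left (by fun_prop), lintegral_const,
          measure_univ, mul_one]
    _ ≤ ENNReal.ofReal n * (1 + (1 + (1 + ENNReal.ofReal (|x₀| + α * T + β * T + 1)))) := by
        gcongr
    _ = _ := by
        rw [ENNReal.ofReal_add (p := 3) (by positivity) (by positivity), ENNReal.ofReal_ofNat]
        congr 1
        rw [← add_assoc, ← add_assoc]
        norm_num

end Family

end DoubleEnded

open DoubleEnded in
theorem theorem3 {Ω : ℕ+ → Type*} [∀ n, MeasurableSpace (Ω n)]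
    (P : ∀ n, Measure (Ω n)) [∀ n, IsProbabilityMeasure (P n)]
    (Q : ∀ n, DoubleEnded.DoubleEndedQueue (Ω n) (P n))
    (α β σ ς θ γ x₀ : ℝ)
    (hα : 0 < α) (hβ : 0 < β) (hσ : 0 < σ) (hς : 0 < ς) (hθ : 0 < θ) (hγ : 0 < γ)
    (hU : DoubleEnded.UniformlyIntegrableFamily P (fun n ω => (Q n).U 0 ω ^ 2))
    (hV : DoubleEnded.UniformlyIntegrableFamily P (fun n ω => (Q n).V 0 ω ^ 2))
    (hαn : Tendsto (fun n : ℕ+ => (Q n).α) atTop (𝓝 α))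
    (hβn : Tendsto (fun n : ℕ+ => (Q n).β) atTop (𝓝 β))
    (hσn : Tendsto (fun n : ℕ+ => (Q n).σ) atTop (𝓝 σ))
    (hςn : Tendsto (fun n : ℕ+ => (Q n).ς) atTop (𝓝 ς))
    (hθn : Tendsto (fun n : ℕ+ => (n : ℝ) * (Q n).θ) atTop (𝓝 θ))
    (hγn : Tendsto (fun n : ℕ+ => (n : ℝ) * (Q n).γ) atTop (𝓝 γ))
    (h₀ : Tendsto (fun n : ℕ+ =>
        ∫⁻ ω, ENNReal.ofReal |(Q n).fluidScaled n 0 ω - x₀| ∂(P n)) atTop (𝓝 0)) :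
    ∃ x : ℝ → ℝ, DoubleEnded.IsFluidSolution α β θ γ x₀ x ∧
      (∀ y : ℝ → ℝ, DoubleEnded.IsFluidSolution α β θ γ x₀ y → Set.EqOn y x (Set.Ici 0)) ∧
      ∀ t : ℝ, 0 ≤ t → Tendsto (fun n : ℕ+ =>
        ∫⁻ ω, ⨆ s ∈ Set.Icc (0 : ℝ) t,
          ENNReal.ofReal |(Q n).fluidScaled n s ω - x s| ∂(P n)) atTop (𝓝 0) := by
  obtain ⟨x, hx⟩ := exists_isFluidSolution (α := α) (β := β) hθ.le hγ.le x₀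
  refine ⟨x, hx, fun y hy => hx.eqOn hθ.le hγ.le hy, fun T hT => ?_⟩
  refine tendsto_zero_of_forall_ofReal fun ε hε => ?_
  set C := Real.exp ((θ + γ) * T)
  have hC0 : 0 < C := Real.exp_pos _
  set δ := ε / (6 * C) with hδ
  have hδ0 : 0 < δ := by positivity
  obtain ⟨K, hK, hκ⟩ := DoubleEndedQueue.exists_eventually_lintegral_pathBound_le hα hβ hαn hβn
    hσn hςn h₀ hT
  obtain ⟨mU, hmU, hUn⟩ := exists_eventually_lintegral_renewalGridError_le
    (fun n => (Q n).interarrival_sellers) hα hαn hσn hT hδ0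
  obtain ⟨mV, hmV, hVn⟩ := exists_eventually_lintegral_renewalGridError_le
    (fun n => (Q n).interarrival_buyers) hβ hβn hςn hT hδ0
  have hθT : ∀ n : ℕ+, 0 ≤ n * (Q n).θ * T := fun n => by
    have := (Q n).θ_pos
    positivity
  have hγT : ∀ n : ℕ+, 0 ≤ n * (Q n).γ * T := fun n => by
    have := (Q n).γ_pos
    positivity
  obtain ⟨ms, hms, hsn⟩ := exists_eventually_lintegral_gridError_le hK
    (fun n => (Q n).poisson_sellers) (fun n => (Q n).measurable_pathBound (n * T))
    (fun n r => ((Q n).indepFun_pathBound (n * T) r).1) hθT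
    ((hθn.mul_const T).eventually_le_const (lt_add_one _)) hκ hδ0
  obtain ⟨mb, hmb, hbn⟩ := exists_eventually_lintegral_gridError_le hK
    (fun n => (Q n).poisson_buyers) (fun n => (Q n).measurable_pathBound (n * T))
    (fun n r => ((Q n).indepFun_pathBound (n * T) r).2) hγT
    ((hγn.mul_const T).eventually_le_const (lt_add_one _)) hκ hδ0
  have hrate : Tendsto (fun n : ℕ+ => (|n * (Q n).θ - θ| + |n * (Q n).γ - γ|) * T * K) atTop
      (𝓝 ((|θ - θ| + |γ - γ|) * T * K)) :=
    (((hθn.sub_const θ).abs.add (hγn.sub_const γ).abs).mul_const T).mul_const K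
  simp only [sub_self, abs_zero, add_zero, zero_mul] at hrate
  filter_upwards [hκ, hUn, hVn, hsn, hbn, hrate.eventually_le_const hδ0,
    h₀.eventually_le_const (ENNReal.ofReal_pos.2 hδ0)] with n hκ hUn hVn hsn hbn hrate h₀
  have hn : (0 : ℝ) < n := by exact_mod_cast n.pos
  have hr0 : 0 ≤ (|n * (Q n).θ - θ| + |n * (Q n).γ - γ|) * T := by positivity
  have hlast : ∫⁻ ω, ENNReal.ofReal ((|n * (Q n).θ - θ| + |n * (Q n).γ - γ|) * T *
      ((Q n).pathBound (n * T) ω / n)) ∂(P n) ≤ ENNReal.ofReal δ := by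
    simp_rw [ENNReal.ofReal_mul hr0]
    rw [lintegral_const_mul' _ _ ENNReal.ofReal_ne_top, lintegral_ofReal_div _ hn]
    simp_rw [ENNReal.ofReal_natCast]
    refine (mul_le_mul_right (ENNReal.div_le_of_le_mul (b := ENNReal.ofReal K) ?_) _).trans ?_
    · rwa [ENNReal.ofReal_mul hn.le, ENNReal.ofReal_natCast,
        mul_comm ((n : ℕ) : ℝ≥0∞)] at hκ
    · rw [← ENNReal.ofReal_mul hr0]
      exact ENNReal.ofReal_le_ofReal hrate
  have m0 := (Q n).measurable_fluidScaled n le_rfl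
  have m1 := measurable_renewalGridError (Q n).interarrival_sellers.measurable n mU α T
  have m2 := measurable_renewalGridError (Q n).interarrival_buyers.measurable n mV β T
  have m3 := measurable_gridError (Q n).poisson_sellers.measurable
    ((Q n).measurable_pathBound (n * T)) (n * (Q n).θ * T) ms
  have m4 := measurable_gridError (Q n).poisson_buyers.measurable
    ((Q n).measurable_pathBound (n * T)) (n * (Q n).γ * T) mb
  set f0 : Ω n → ℝ := fun ω => |(Q n).fluidScaled n 0 ω - x₀|
  set f1 : Ω n → ℝ := renewalGridError (Q n).U n mU α T
  set f2 : Ω n → ℝ := renewalGridError (Q n).V n mV β T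
  set f3 : Ω n → ℝ := fun ω =>
    gridError (Q n).Nsr ms (n * (Q n).θ * T * (Q n).pathBound (n * T) ω) ω / n
  set f4 : Ω n → ℝ := fun ω =>
    gridError (Q n).Nbr mb (n * (Q n).γ * T * (Q n).pathBound (n * T) ω) ω / n
  set f5 : Ω n → ℝ := fun ω => (|n * (Q n).θ - θ| + |n * (Q n).γ - γ|) * T *
      ((Q n).pathBound (n * T) ω / n)
  have m0' : Measurable f0 := (m0.sub_const x₀).abs
  have m3' : Measurable f3 := m3.div_const _
  have m4' : Measurable f4 := m4.div_const _
  calc _ ≤ ∫⁻ ω, ENNReal.ofReal C * (ENNReal.ofReal (f0 ω) + (ENNReal.ofReal (f1 ω) +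
        (ENNReal.ofReal (f2 ω) + (ENNReal.ofReal (f3 ω) + (ENNReal.ofReal (f4 ω) +
          ENNReal.ofReal (f5 ω)))))) ∂(P n) := by
        refine lintegral_mono_ae ?_
        filter_upwards [(Q n).ae_abs_fluidScaled_sub_le n hα.le hβ.le hθ.le hγ.le hT hx hmU hmV
          hms hmb] with ω hω
        refine iSup₂_le fun s hs => (ENNReal.ofReal_le_ofReal (hω s hs)).trans ?_
        rw [mul_comm, ENNReal.ofReal_mul hC0.le]
        gcongr
        have e : |(Q n).fluidScaled n 0 ω - x₀| + (Q n).fluidError n α β θ γ T mU mV ms mb ω =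
            f0 ω + (f1 ω + (f2 ω + (f3 ω + (f4 ω + f5 ω)))) := by
          simp only [DoubleEndedQueue.fluidError, f0, f1, f2, f3, f4, f5]
          ring
        rw [e]
        refine ENNReal.ofReal_add_le.trans (add_le_add_right ?_ _)
        refine ENNReal.ofReal_add_le.trans (add_le_add_right ?_ _)
        refine ENNReal.ofReal_add_le.trans (add_le_add_right ?_ _)
        refine ENNReal.ofReal_add_le.trans (add_le_add_right ?_ _)
        exact ENNReal.ofReal_add_le
    _ = ENNReal.ofReal C * (∫⁻ ω, ENNReal.ofReal (f0 ω) ∂(P n) +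
        (∫⁻ ω, ENNReal.ofReal (f1 ω) ∂(P n) + (∫⁻ ω, ENNReal.ofReal (f2 ω) ∂(P n) +
        (∫⁻ ω, ENNReal.ofReal (f3 ω) ∂(P n) + (∫⁻ ω, ENNReal.ofReal (f4 ω) ∂(P n) +
          ∫⁻ ω, ENNReal.ofReal (f5 ω) ∂(P n)))))) := by
        rw [lintegral_const_mul' _ _ ENNReal.ofReal_ne_top, lintegral_add_left m0'.ennreal_ofReal,
          lintegral_add_left m1.ennreal_ofReal, lintegral_add_left m2.ennreal_ofReal,
          lintegral_add_left m3'.ennreal_ofReal, lintegral_add_left m4'.ennreal_ofReal]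
    _ ≤ ENNReal.ofReal C * (ENNReal.ofReal δ + (ENNReal.ofReal δ + (ENNReal.ofReal δ +
        (ENNReal.ofReal δ + (ENNReal.ofReal δ + ENNReal.ofReal δ))))) := by
        gcongr
    _ = ENNReal.ofReal ε := by
        rw [← ENNReal.ofReal_add (by positivity) (by positivity),
          ← ENNReal.ofReal_add (by positivity) (by positivity),
          ← ENNReal.ofReal_add (by positivity) (by positivity),
          ← ENNReal.ofReal_add (by positivity) (by positivity),
          ← ENNReal.ofReal_add (by positivity) (by positivity), ← ENNReal.ofReal_mul hC0.le]
        congr 1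
        rw [hδ]
        field_simp
        norm_num
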